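/- **Setting.** Let $k$ be a field and $n\ge 1$; order monomials of $k[X]=k[X_1,\dots,X_n]$ lexicographically with $X_1\succ\dots\succ X_n$ and identify $X^d$ with $d\in\mathbb N_0^n$. For a lower set $D\subseteq\mathbb N_0^n$ let $E(D)=\{\beta\notin D:\ \beta-e_i\in D \text{ whenever } \beta_i\ne0\}$. Let $H=\{\langle p_1,D_1\rangle,\dots,\langle p_t,D_t\rangle\}$, $t\ge1$, be a set of pairwise distinct points $p_u\in k^n$ with finite lower sets $D_u\subseteq\mathbb N_0^n$ as multiplicity structures. A polynomial $f$ vanishes on $H$ if $\frac{\partial^{d_1+\dots+d_n}f}{\partial x_1^{d_1}\cdots\partial x_n^{d_n}}(p_u)=0$ for all $u$ and all $d\in D_u$. For $d\in\mathbb N_0^n$ write $\hat d=(d_1,\dots,d_{n-1})$. The sum $D+D'$ of finite lower sets is obtained by dropping a far translate of $D'$ along the last axis onto $D$: $D+D'=D\cup\{(\hat d,\ d_n+\#\{e\in D:\hat e=\hat d\}): d\in D'\}$. Let $\mathrm{GLT}(a,D)$ be the element $(\hat a,r)$ with $r$ minimal such that $(\hat a,r)\notin D$. **Definition of $D(H)$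 and $\mathrm{poly}(H)$, by induction on $n$.** *$n=1$:* $D(H)=\{0,\dots,m-1\}$ with $m=\sum_u\#D_u$, and $\mathrm{poly}(H)=\{\prod_u(X_1-p_u)^{\# D_u}\}$. *$n\ge2$, all points with the same last coordinate $c$:* let $w$ be the largest last entry of an element of $\bigcup_u D_u$ (with $w+1:=0$ if this union is empty). For $0\le i\le w$ let $H^{(i)}$ be the set of the $(n-1)$-dimensional points $\langle\hat p_u,\{\hat d: d\in D_u, d_n=i\}\rangle$ whose second component is non-empty. Then $D(H)=\bigcup_{i=0}^w D(H^{(i)})\times\{i\}$, and $\mathrm{poly}(H)$ consists of those elements of $\bigcup_{i=0}^w (X_n-c)^i\,\mathrm{poly}(H^{(i)})\cup\{(X_n-c)^{w+1}\}$ whose leading exponent lies in $E(D(H))$. *$n\ge2$, general case:* let $H_1,\dots,H_s$ be the fibres of $H$ over the distinct last coordinates $c_1,\dots,c_s$ occurring in $H$, listed in any order, and let $D'_i=D(H_i)$, $G_i=\mathrm{poly}(H_i)$, and $w_i$ (the number $w$ for $H_i$) be given by the previous case. Put $D(H)=D'_1+\dots+D'_s$. Start with $D=D'_1$, $G=G_1$.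 For $i=2,\dots,s$: set $D^{\mathrm{new}}=D+D'_i$ and $\hat G=\varnothing$, and run through $a\in E(D^{\mathrm{new}})$ in increasing lexicographic order. For each $a$, take $f_1=g\cdot X^{b-b'}$, where $b=\mathrm{GLT}(a,D)$, $b'\in E(D)$ divides $b$, and $g\in G$ has leading exponent $b'$; take $f_2$ in the same way from $D'_i,G_i$. Let $v_j$ be the last entry of $\mathrm{GLT}(a,D'_j)$. Choose univariate $r_1,r_2\in k[X_n]$ (for example by the extended Euclidean algorithm) with $$r_1(X_n-c_i)^{w_i+1-v_i}+r_2\prod_{j<i}(X_n-c_j)^{w_j+1-v_j}=1,$$ form $f=r_1f_1(X_n-c_i)^{w_i+1}+r_2f_2\prod_{j<i}(X_n-c_j)^{w_j+1}$, and add to $\hat G$ a remainder $f'$ of $f$ on division by $\hat G$. After all $a$ are treated, set $D:=D^{\mathrm{new}}$, $G:=\hat G$. Finally $\mathrm{poly}(H):=G$. **Theorem 3.** For every such $H$ the construction can be carried out, and for every choice made in it (order of the fibres, $b'$ and $g$, cofactors $r_1,r_2$, remainders) the resulting set satisfies the following: there are polynomials $f_\lambda$, $\lambda\in E(D(H))$,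 such that for each $\lambda\in E(D(H))$ - the lexicographic leading term of $f_\lambda$ is $X^\lambda$; - the exponents of all other terms of $f_\lambda$ lie in $D(H)$; - $f_\lambda$ vanishes on $H$; and $\mathrm{poly}(H)=\{f_\lambda:\lambda\in E(D(H))\}$. -/

import Mathlib

namespace PointIdeal

/-- Exponent vectors in `ℕ^n`, identified with monomials in `n` variables. -/
abbrev Expo (n : ℕ) : Type := Fin n →₀ ℕ

/-- A finite collection of pairs `⟨p, D⟩` of a point `p ∈ k^n` and a finite set `D ⊆ ℕ^n`. -/
abbrev PointSet (k : Type*) (n : ℕ) : Type _ := Finset ((Fin n → k) × Finset (Expo n))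

/-- `H` is a set of points with multiplicity structures: the points are pairwise distinct and
every multiplicity structure is a lower set. -/
def PointSet.IsValid {k : Type*} {n : ℕ} (H : PointSet k n) : Prop :=
  (∀ x ∈ H, IsLowerSet (x.2 : Set (Expo n))) ∧ ∀ x ∈ H, ∀ y ∈ H, x.1 = y.1 → x = y

/-- The limiting set `E(D)`. -/
def limitingSet {n : ℕ} (D : Finset (Expo n)) : Set (Expo n) :=
  {b | b ∉ D ∧ ∀ i, b i ≠ 0 → b - Finsupp.single i 1 ∈ D}

/-! ### The functionals -/

/-- The iterated partial derivative `∂^(d₁+⋯+dₙ) f / ∂x₁^d₁ ⋯ ∂xₙ^dₙ`. -/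
noncomputable def mixedDeriv {k : Type*} [Field k] {n : ℕ} (d : Expo n)
    (f : MvPolynomial (Fin n) k) : MvPolynomial (Fin n) k :=
  (List.finRange n).foldr (fun i g => (MvPolynomial.pderiv i)^[d i] g) f

/-- `f` is annihilated by all the functionals defined by `H`. -/
def VanishesOn {k : Type*} [Field k] {n : ℕ} (H : PointSet k n)
    (f : MvPolynomial (Fin n) k) : Prop :=
  ∀ x ∈ H, ∀ d ∈ x.2, MvPolynomial.eval x.1 (mixedDeriv d f) = 0

/-! ### Projections and embeddings -/

/-- The last entry of an exponent vector. -/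
def proj {n : ℕ} (d : Expo (n + 1)) : ℕ := d (Fin.last n)

/-- Forget the last entry. -/
noncomputable def projHat {n : ℕ} (d : Expo (n + 1)) : Expo n :=
  d.comapDomain Fin.castSucc (Fin.castSucc_injective n).injOn

/-- Append `c` as last entry. -/
noncomputable def embed {n : ℕ} (c : ℕ) (d : Expo n) : Expo (n + 1) :=
  d.mapDomain Fin.castSucc + Finsupp.single (Fin.last n) c

/-! ### Addition of lower sets -/

/-- The number of elements of `D` in the column of `a` (same entries except possibly the last). -/
noncomputable def columnHeight {n : ℕ} (D : Finset (Expo (n + 1))) (a : Expo n) : ℕ :=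
  (D.filter (fun d => projHat d = a)).card

/-- The addition of lower sets: the elements of `D₂`, translated far out along the last axis, are
dropped along that axis until they lie on top of the elements of `D₁`. -/
noncomputable def addLower {n : ℕ} (D₁ D₂ : Finset (Expo (n + 1))) : Finset (Expo (n + 1)) :=
  D₁ ∪ D₂.image (fun d => embed (columnHeight D₁ (projHat d) + proj d) (projHat d))

/-! ### Fibres and slices of a set of points -/

open scoped Classical in
/-- The last coordinates occurring in `H`. -/
noncomputable def lastCoords {k : Type*} {n : ℕ} (H : PointSet k (n + 1)) : Finset k :=
  H.image (fun x => x.1 (Fin.last n))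

open scoped Classical in
/-- The `π`-fibre of `H` over `c`: the points with last coordinate `c`. -/
noncomputable def fibre {k : Type*} {n : ℕ} (H : PointSet k (n + 1)) (c : k) :
    PointSet k (n + 1) :=
  H.filter (fun x => x.1 (Fin.last n) = c)

/-- `w + 1`, where `w` is the largest last entry of an element of a multiplicity structure
in `H` (and `0` if there is no such element). -/
def levels {k : Type*} {n : ℕ} (H : PointSet k (n + 1)) : ℕ :=
  H.sup (fun x => x.2.sup (fun d => proj d + 1))

open scoped Classical in
/-- The functionals of `H` whose exponent vector has last entry `i`, with last coordinates of points
and exponent vectors eliminated; points without such a functional are left out. -/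
noncomputable def slice {k : Type*} {n : ℕ} (H : PointSet k (n + 1)) (i : ℕ) : PointSet k n :=
  (H.image (fun x => ((fun j => x.1 (Fin.castSucc j) : Fin n → k),
      (x.2.filter (fun d => proj d = i)).image projHat))).filter (fun y => y.2.Nonempty)

/-! ### The lower set `D(H)` -/

/-- The lower set of a set of points with a common last coordinate, obtained from the lower sets
`DD` of sets of points in one dimension less. -/
noncomputable def specialLowerSet {k : Type*} {n : ℕ}
    (DD : PointSet k n → Finset (Expo n)) (H : PointSet k (n + 1)) : Finset (Expo (n + 1)) :=
  (Finset.range (levels H)).biUnion (fun i => (DD (slice H i)).image (embed i))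

/-- The lower set `D(H)`, by induction over the dimension, which is `n + 1`. In dimension one
it is `{0, …, m - 1}` with `m` the number of functionals; in higher dimension it is the sum of the
lower sets of the `π`-fibres. -/
noncomputable def lowerSetOf {k : Type*} :
    (n : ℕ) → PointSet k (n + 1) → Finset (Expo (n + 1))
  | 0, H => (Finset.range (∑ x ∈ H, x.2.card)).image (Finsupp.single 0)
  | n + 1, H => (lastCoords H).toList.foldl
      (fun D c => addLower D (specialLowerSet (lowerSetOf n) (fibre H c))) ∅

/-! ### The set of polynomials `poly(H)`

The algorithm leaves choices open (order of the fibres, selection of a factor, the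
cofactors, the quotients in a reduction), so it is described as a relation between input and
possible output. The monomial order is lexicographic with `X₁ ≻ X₂ ≻ ⋯ ≻ Xₙ`. -/

/-- `X_n - c`, with `X_n` the last variable. -/
noncomputable def lastSub {k : Type*} [Field k] (n : ℕ) (c : k) : MvPolynomial (Fin (n + 1)) k :=
  MvPolynomial.X (Fin.last n) - MvPolynomial.C c

/-- A univariate polynomial, regarded as a polynomial in the last variable. -/
noncomputable def inLast {k : Type*} [Field k] (n : ℕ) (r : Polynomial k) :
    MvPolynomial (Fin (n + 1)) k :=
  Polynomial.aeval (MvPolynomial.X (Fin.last n)) r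

open scoped Classical in
/-- `G` is a possible `poly(H)` for a set `H` of points with common last coordinate `c`;
`DD` and `PP` provide the lower sets and the possible polynomial sets in one dimension less. -/
def IsSpecialPoly {k : Type*} [Field k] {n : ℕ} (DD : PointSet k n → Finset (Expo n))
    (PP : PointSet k n → Finset (MvPolynomial (Fin n) k) → Prop)
    (H : PointSet k (n + 1)) (c : k) (G : Finset (MvPolynomial (Fin (n + 1)) k)) : Prop :=
  ∃ Gt : ℕ → Finset (MvPolynomial (Fin n) k),
    (∀ i < levels H, PP (slice H i) (Gt i)) ∧
    G = (((Finset.range (levels H)).biUnion (fun i => (Gt i).image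
            (fun g => MvPolynomial.rename Fin.castSucc g * lastSub n c ^ i))) ∪
          {lastSub n c ^ levels H}).filter
        (fun g => MonomialOrder.lex.degree g ∈ limitingSet (specialLowerSet DD H))

/-- `GLT(a, D)`: the lowest element outside `D` of the column of `a`. -/
noncomputable def glt {n : ℕ} (a : Expo (n + 1)) (D : Finset (Expo (n + 1))) : Expo (n + 1) :=
  embed (sInf {r : ℕ | embed r (projHat a) ∉ D}) (projHat a)

/-- `p` is a possible result of `GLP(a, D, G)`: with `t = GLT(a, D)`, some `t' ∈ E(D)` dividing `t`
and some `f ∈ G` with leading exponent `t'`, it is `f · X^(t - t')`. -/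
def IsGLP {k : Type*} [Field k] {n : ℕ} (a : Expo (n + 1)) (D : Finset (Expo (n + 1)))
    (G : Finset (MvPolynomial (Fin (n + 1)) k)) (p : MvPolynomial (Fin (n + 1)) k) : Prop :=
  ∃ t' ∈ limitingSet D, t' ≤ glt a D ∧
    ∃ f ∈ G, MonomialOrder.lex.degree f = t' ∧ p = f * MvPolynomial.monomial (glt a D - t') 1

/-- `f'` is a result of reducing `f` with the elements of `G`: a remainder of `f` on
division by `G` with respect to the lexicographic order. -/
def IsReduction {k : Type*} [Field k] {n : ℕ} (G : Finset (MvPolynomial (Fin n) k))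
    (f f' : MvPolynomial (Fin n) k) : Prop :=
  ∃ h : MvPolynomial (Fin n) k → MvPolynomial (Fin n) k,
    f = ∑ g ∈ G, g * h g + f' ∧
    (∀ g ∈ G, MonomialOrder.lex.toSyn (MonomialOrder.lex.degree (g * h g)) ≤
      MonomialOrder.lex.toSyn (MonomialOrder.lex.degree f)) ∧
    ∀ m ∈ f'.support, ∀ g ∈ G, ¬ MonomialOrder.lex.degree g ≤ m

/-- `f` is a possible combination, for the exponent vector `a`, of the polynomial set `G` with lower set `D`
of the fibres over `S` and the polynomial set `Gc` of the fibre over `c`. Here `D'` gives the lower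
set of each fibre and `L` the number `w + 1` of each fibre. -/
def IsCombination {k : Type*} [Field k] {n : ℕ} (D' : k → Finset (Expo (n + 1))) (L : k → ℕ)
    (S : Finset k) (D : Finset (Expo (n + 1))) (G : Finset (MvPolynomial (Fin (n + 1)) k))
    (c : k) (Gc : Finset (MvPolynomial (Fin (n + 1)) k))
    (a : Expo (n + 1)) (f : MvPolynomial (Fin (n + 1)) k) : Prop :=
  ∃ (f₁ f₂ : MvPolynomial (Fin (n + 1)) k) (r₁ r₂ : Polynomial k),
    IsGLP a D G f₁ ∧ IsGLP a (D' c) Gc f₂ ∧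
    r₁ * (Polynomial.X - Polynomial.C c) ^ (L c - proj (glt a (D' c))) +
      r₂ * ∏ b ∈ S, (Polynomial.X - Polynomial.C b) ^ (L b - proj (glt a (D' b))) = 1 ∧
    f = inLast n r₁ * (f₁ * lastSub n c ^ L c) +
        inLast n r₂ * (f₂ * ∏ b ∈ S, lastSub n b ^ L b)

/-- The states of the inner loop, which runs through `E` in increasing lexicographic order.
The first argument after `comb` is the set of the exponent vectors still to be treated, the second
the set of polynomials obtained so far; `comb a f` says that `f` is a possible combination for `a`. -/
inductive InnerLoop {k : Type*} [Field k] {n : ℕ} (E : Set (Expo n))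
    (comb : Expo n → MvPolynomial (Fin n) k → Prop) :
    Set (Expo n) → Finset (MvPolynomial (Fin n) k) → Prop
  | start : InnerLoop E comb E ∅
  | step (MS : Set (Expo n)) (Gh Gh' : Finset (MvPolynomial (Fin n) k)) (a : Expo n)
      (f f' : MvPolynomial (Fin n) k) :
      InnerLoop E comb MS Gh → a ∈ MS →
      (∀ b ∈ MS, MonomialOrder.lex.toSyn a ≤ MonomialOrder.lex.toSyn b) →
      comb a f → IsReduction Gh f f' → (∀ g, g ∈ Gh' ↔ g ∈ Gh ∨ g = f') →
      InnerLoop E comb (MS \ {a}) Gh'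

/-- The states of the outer loop, which adds the fibres one by one: the set of the last coordinates
treated so far, the sum of the lower sets of these fibres, and the polynomial set for it. `C` is the
set of all last coordinates, and `PF c Gc` says that `Gc` is a possible polynomial set of the fibre
over `c`. -/
inductive OuterLoop {k : Type*} [Field k] {n : ℕ} (C : Finset k)
    (D' : k → Finset (Expo (n + 1))) (L : k → ℕ)
    (PF : k → Finset (MvPolynomial (Fin (n + 1)) k) → Prop) :
    Finset k → Finset (Expo (n + 1)) → Finset (MvPolynomial (Fin (n + 1)) k) → Prop
  | start (c : k) (Gc : Finset (MvPolynomial (Fin (n + 1)) k)) :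
      c ∈ C → PF c Gc → OuterLoop C D' L PF {c} (D' c) Gc
  | step (S : Finset k) (D : Finset (Expo (n + 1)))
      (G Gc Gh : Finset (MvPolynomial (Fin (n + 1)) k)) (c : k) (hc : c ∉ S) :
      OuterLoop C D' L PF S D G → c ∈ C → PF c Gc →
      InnerLoop (limitingSet (addLower D (D' c))) (IsCombination D' L S D G c Gc) ∅ Gh →
      OuterLoop C D' L PF (S.cons c hc) (addLower D (D' c)) Gh

/-- `G` is a possible `poly(H)`, by induction over the dimension, which is `n + 1`. -/
def IsPoly {k : Type*} [Field k] :
    (n : ℕ) → PointSet k (n + 1) → Finset (MvPolynomial (Fin (n + 1)) k) → Prop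
  | 0, H, G => G = {∏ x ∈ H, (MvPolynomial.X 0 - MvPolynomial.C (x.1 0)) ^ x.2.card}
  | n + 1, H, G => ∃ D : Finset (Expo (n + 2)),
      OuterLoop (lastCoords H)
        (fun c => specialLowerSet (lowerSetOf n) (fibre H c))
        (fun c => levels (fibre H c))
        (fun c Gc => IsSpecialPoly (lowerSetOf n) (IsPoly n) (fibre H c) c Gc)
        (lastCoords H) D G

/-- The property of a polynomial set `G` for `H` with lower set `D`: it consists of polynomials
`f_a`, `a ∈ E(D)`, with leading term `X^a`, with all lower terms in `D`, and vanishing on `H`. -/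
def SatisfiesAssumption {k : Type*} [Field k] {n : ℕ} (H : PointSet k n) (D : Finset (Expo n))
    (G : Finset (MvPolynomial (Fin n) k)) : Prop :=
  ∃ f : Expo n → MvPolynomial (Fin n) k,
    (∀ a ∈ limitingSet D,
      MonomialOrder.lex.leadingTerm (f a) = MvPolynomial.monomial a 1 ∧
      (∀ m ∈ (f a).support, m ≠ a → m ∈ D) ∧
      VanishesOn H (f a)) ∧
    (G : Set (MvPolynomial (Fin n) k)) = f '' limitingSet D

end PointIdeal

namespace PointIdeal

open MvPolynomial

/-! ### Exponent vectors -/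

/-! Read polynomials as polynomials in `X₁, …, Xₙ₋₁` over `k[Xₙ]`. Since `Xₙ` is the smallest
variable, the lexicographic leading exponent is found by taking the leading exponent `μ` in the
first variables, then the degree of its coefficient in `k[Xₙ]`; `HatLead f μ p` records this
coefficient `p`. A finite lower set is the region under an antitone height function `columnHeight`,
addition of lower sets adds heights, and an element `a` of `E(D)` sits exactly on top of its column.
So it is enough to produce elements with monic leading coefficient of degree equal to the height
over `â`.

Over one fibre, slice by slice, that coefficient is `(Xₙ - c)^h` with `h` the height
(`IsSpecialPoly.isLeadingSystem`). For several fibres it is the product of these powers. Indeed, the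
factors `f₁`, `f₂` of a combination have leading coefficients `p₁`, `p₂` given by the heights
(`IsLeadingSystem.of_isGLP`), and after splitting off `p₁ p₂` the Bézout relation says that the
combination has leading coefficient exactly `p₁ p₂` (`IsCombination.hatLead_and_mem`). It vanishes
on all fibres concerned: each summand contains, for every fibre, either a factor already vanishing
there or a power of `Xₙ - c` that exceeds all multiplicities.

Reduction by the earlier polynomials does not touch the column of `a`, so the leading coefficient
survives. A remaining term other than `X^a` outside `D` would be divisible by some `X^e` with `e ∈
E(D)` smaller than `a`, hence already treated, contrary to being a remainder
(`IsPartialSystem.isSystemElement`). Monic divisors and coprime powers ensure that no step can fail.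
Induction on the dimension supplies the polynomial sets of the slices. -/

@[simp]
lemma projHat_apply {n : ℕ} (d : Expo (n + 1)) (i : Fin n) : projHat d i = d i.castSucc := rfl

@[simp]
lemma embed_castSucc {n : ℕ} (c : ℕ) (d : Expo n) (i : Fin n) : embed c d i.castSucc = d i := by
  simp [embed, Finsupp.mapDomain_apply (Fin.castSucc_injective n)]

@[simp]
lemma embed_last {n : ℕ} (c : ℕ) (d : Expo n) : embed c d (Fin.last n) = c := by
  rw [embed, Finsupp.add_apply, Finsupp.mapDomain_of_notMem_range, Finsupp.single_eq_same, zero_add]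
  rintro ⟨i, hi⟩
  exact (Fin.castSucc_lt_last i).ne hi

@[simp]
lemma proj_embed {n : ℕ} (c : ℕ) (d : Expo n) : proj (embed c d) = c := embed_last c d

@[simp]
lemma projHat_embed {n : ℕ} (c : ℕ) (d : Expo n) : projHat (embed c d) = d := by
  ext i; simp

lemma expo_ext {n : ℕ} {a b : Expo (n + 1)} (h : projHat a = projHat b) (h' : proj a = proj b) :
    a = b := by
  ext i
  refine Fin.lastCases h' (fun j => ?_) i
  exact DFunLike.congr_fun h j

@[simp]
lemma embed_proj_projHat {n : ℕ} (a : Expo (n + 1)) : embed (proj a) (projHat a) = a :=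
  expo_ext (by simp) (by simp)

lemma expo_le_iff {n : ℕ} {a b : Expo (n + 1)} :
    a ≤ b ↔ projHat a ≤ projHat b ∧ proj a ≤ proj b := by
  constructor
  · exact fun h => ⟨fun i => h _, h _⟩
  · rintro ⟨h, h'⟩ i
    refine Fin.lastCases h' (fun j => ?_) i
    exact h j

@[simp]
lemma proj_add {n : ℕ} (a b : Expo (n + 1)) : proj (a + b) = proj a + proj b := rfl

@[simp]
lemma projHat_add {n : ℕ} (a b : Expo (n + 1)) : projHat (a + b) = projHat a + projHat b := by
  ext i; simp

@[simp]
lemma proj_sub {n : ℕ} (a b : Expo (n + 1)) : proj (a - b) = proj a - proj b := rfl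

@[simp]
lemma projHat_sub {n : ℕ} (a b : Expo (n + 1)) : projHat (a - b) = projHat a - projHat b := by
  ext i; simp

@[simp]
lemma proj_single_castSucc {n : ℕ} (i : Fin n) (c : ℕ) :
    proj (Finsupp.single i.castSucc c) = 0 := by
  simp [proj, (Fin.castSucc_lt_last i).ne']

@[simp]
lemma projHat_single_castSucc {n : ℕ} (i : Fin n) (c : ℕ) :
    projHat (Finsupp.single i.castSucc c) = Finsupp.single i c := by
  ext j; simp [Finsupp.single_apply]

@[simp]
lemma proj_single_last {n : ℕ} (c : ℕ) : proj (Finsupp.single (Fin.last n) c) = c := by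
  simp [proj]

@[simp]
lemma projHat_single_last {n : ℕ} (c : ℕ) : projHat (Finsupp.single (Fin.last n) c) = 0 := by
  ext j; simp

/-! ### The lexicographic order -/

/-- Strict lexicographic comparison of exponent vectors. -/
def lexLT {n : ℕ} (a b : Expo n) : Prop :=
  MonomialOrder.lex.toSyn a < MonomialOrder.lex.toSyn b

lemma lexLT_iff {n : ℕ} {a b : Expo n} :
    lexLT a b ↔ ∃ i, (∀ j < i, a j = b j) ∧ a i < b i :=
  Iff.rfl

/-- `Xₙ` is the smallest variable, so the last entry only breaks ties. This is what makes leading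
coefficients in `k[Xₙ]` compatible with the order. -/
lemma lexLT_succ_iff {n : ℕ} {a b : Expo (n + 1)} :
    lexLT a b ↔ lexLT (projHat a) (projHat b) ∨ projHat a = projHat b ∧ proj a < proj b := by
  simp only [lexLT_iff]
  constructor
  · rintro ⟨i, h, h'⟩
    induction i using Fin.lastCases with
    | last =>
      refine Or.inr ⟨?_, h'⟩
      ext j
      exact h _ (Fin.castSucc_lt_last j)
    | cast i =>
      exact Or.inl ⟨i, fun j hj => h _ (Fin.castSucc_lt_castSucc_iff.2 hj), h'⟩
  · rintro (⟨i, h, h'⟩ | ⟨h, h'⟩)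
    · refine ⟨i.castSucc, fun j hj => ?_, h'⟩
      induction j using Fin.lastCases with
      | last => exact absurd hj (Fin.castSucc_lt_last i).le.not_gt
      | cast j => exact h j (Fin.castSucc_lt_castSucc_iff.1 hj)
    · refine ⟨Fin.last n, fun j hj => ?_, h'⟩
      induction j using Fin.lastCases with
      | last => exact absurd hj (lt_irrefl _)
      | cast j => exact DFunLike.congr_fun h j

lemma lexLT_irrefl {n : ℕ} (a : Expo n) : ¬ lexLT a a := lt_irrefl _

lemma lexLT.trans {n : ℕ} {a b c : Expo n} (h : lexLT a b) (h' : lexLT b c) : lexLT a c :=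
  lt_trans h h'

lemma lexLT.add_left {n : ℕ} {a b : Expo n} (h : lexLT a b) (c : Expo n) :
    lexLT (c + a) (c + b) := by
  unfold lexLT at *
  rw [map_add, map_add]
  exact add_lt_add_right h _

lemma lexLT_of_le_of_ne {n : ℕ} {a b : Expo n} (h : a ≤ b) (hne : a ≠ b) : lexLT a b :=
  MonomialOrder.lex.toSyn_strictMono (lt_of_le_of_ne h hne)

lemma lexLT_or_eq {n : ℕ} {a b : Expo n} :
    lexLT a b ∨ a = b ↔ MonomialOrder.lex.toSyn a ≤ MonomialOrder.lex.toSyn b := by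
  rw [le_iff_lt_or_eq, EmbeddingLike.apply_eq_iff_eq, lexLT]

/-! ### Limiting sets -/

/-- `E(D)` consists of the minimal elements of the complement of `D`. -/
lemma eq_of_le_of_mem_limitingSet {n : ℕ} {D : Finset (Expo n)}
    (hD : IsLowerSet (D : Set (Expo n))) {a b : Expo n} (ha : a ∈ limitingSet D) (hb : b ∉ D)
    (h : b ≤ a) : b = a := by
  by_contra hne
  obtain ⟨i, hi⟩ : ∃ i, b i < a i := by
    by_contra! hcon
    exact hne (le_antisymm h hcon)
  refine hb (hD (show b ≤ a - Finsupp.single i 1 from fun j => ?_) (ha.2 i (by omega)))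
  have := h j
  rw [Finsupp.tsub_apply, Finsupp.single_apply]
  split_ifs with hij
  · subst hij; omega
  · simpa using this

lemma exists_limitingSet_le {n : ℕ} {D : Finset (Expo n)} {b : Expo n} (hb : b ∉ D) :
    ∃ a ∈ limitingSet D, a ≤ b := by
  obtain ⟨a, hab, ha⟩ := exists_minimal_le_of_wellFoundedLT (· ∉ D) b hb
  refine ⟨a, ⟨ha.prop, fun i hi => ?_⟩, hab⟩
  by_contra hcon
  have hle : a ≤ a - Finsupp.single i 1 := ha.le_of_le hcon tsub_le_self
  have := hle i
  simp at this
  omega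

/-- A nonzero element of `E(D)` is a unit step away from an element of `D`. Finiteness makes the
inner loop terminate. -/
lemma limitingSet_finite {n : ℕ} (D : Finset (Expo n)) : (limitingSet D).Finite := by
  classical
  refine ((({0} : Finset (Expo n)) ∪
    (Finset.univ.biUnion fun i => D.image (· + Finsupp.single i 1))).finite_toSet).subset ?_
  intro a ha
  by_cases h : a = 0
  · simp [h]
  · obtain ⟨i, hi⟩ : ∃ i, a i ≠ 0 := by
      by_contra! hcon
      exact h (Finsupp.ext hcon)
    simp only [Finset.coe_union, Finset.coe_biUnion, Finset.coe_image, Set.mem_union,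
      Set.mem_iUnion, Set.mem_image]
    refine Or.inr ⟨i, by simp, a - Finsupp.single i 1, ha.2 i hi, ?_⟩
    refine tsub_add_cancel_of_le ?_
    intro j
    rw [Finsupp.single_apply]
    split_ifs with hij
    · subst hij; omega
    · exact Nat.zero_le _

/-! ### Mixed derivatives -/

section Derivatives

variable {k : Type*} [Field k]

lemma pderiv_iterate_zero {σ : Type*} (i : σ) (m : ℕ) :
    (pderiv i)^[m] (0 : MvPolynomial σ k) = 0 := by
  induction m with
  | zero => rfl
  | succ m ih => rw [Function.iterate_succ_apply, map_zero, ih]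

lemma pderiv_iterate_add {σ : Type*} (i : σ) (m : ℕ) (f g : MvPolynomial σ k) :
    (pderiv i)^[m] (f + g) = (pderiv i)^[m] f + (pderiv i)^[m] g := by
  induction m generalizing f g with
  | zero => rfl
  | succ m ih => simp only [Function.iterate_succ_apply, map_add, ih]

lemma pderiv_iterate_mul_of_pderiv_eq_zero {σ : Type*} (i : σ) (m : ℕ) {f : MvPolynomial σ k}
    (hf : pderiv i f = 0) (g : MvPolynomial σ k) :
    (pderiv i)^[m] (f * g) = f * (pderiv i)^[m] g := by
  induction m generalizing g with
  | zero => rfl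
  | succ m ih =>
    rw [Function.iterate_succ_apply, Function.iterate_succ_apply, pderiv_mul, hf, zero_mul,
      zero_add, ih]

/-- Leibniz rule with a linear factor. For `m = 0` the truncated `m - 1` is harmless, as its
coefficient is zero. -/
lemma pderiv_iterate_X_mul {σ : Type*} (i : σ) (m : ℕ) (g : MvPolynomial σ k) :
    (pderiv i)^[m] (X i * g) = X i * (pderiv i)^[m] g + m • (pderiv i)^[m - 1] g := by
  induction m generalizing g with
  | zero => simp
  | succ m ih =>
    rw [Function.iterate_succ_apply, pderiv_mul, pderiv_X_self, one_mul, add_comm,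
      pderiv_iterate_add, ih, Function.iterate_succ_apply, add_assoc, Nat.add_sub_cancel]
    congr 1
    rcases m with - | m
    · simp
    · rw [Nat.add_sub_cancel, Function.iterate_succ_apply, succ_nsmul (n := m + 1)]

/-- The composition of the iterated partial derivatives along a list of variables. -/
noncomputable def listDeriv {n : ℕ} (l : List (Fin n)) (d : Expo n) (f : MvPolynomial (Fin n) k) :
    MvPolynomial (Fin n) k :=
  l.foldr (fun i g => (pderiv i)^[d i] g) f

lemma mixedDeriv_eq_listDeriv {n : ℕ} (d : Expo n) (f : MvPolynomial (Fin n) k) :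
    mixedDeriv d f = listDeriv (List.finRange n) d f := rfl

lemma listDeriv_cons {n : ℕ} (i : Fin n) (l : List (Fin n)) (d : Expo n)
    (f : MvPolynomial (Fin n) k) :
    listDeriv (i :: l) d f = (pderiv i)^[d i] (listDeriv l d f) := rfl

lemma listDeriv_congr {n : ℕ} {l : List (Fin n)} {d e : Expo n} (h : ∀ i ∈ l, d i = e i)
    (f : MvPolynomial (Fin n) k) : listDeriv l d f = listDeriv l e f := by
  induction l with
  | nil => rfl
  | cons i l ih =>
    rw [listDeriv_cons, listDeriv_cons, ih (fun j hj => h j (List.mem_cons_of_mem _ hj)),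
      h i List.mem_cons_self]

lemma listDeriv_zero {n : ℕ} (l : List (Fin n)) (d : Expo n) :
    listDeriv l d (0 : MvPolynomial (Fin n) k) = 0 := by
  induction l with
  | nil => rfl
  | cons i l ih => rw [listDeriv_cons, ih, pderiv_iterate_zero]

lemma listDeriv_add {n : ℕ} (l : List (Fin n)) (d : Expo n) (f g : MvPolynomial (Fin n) k) :
    listDeriv l d (f + g) = listDeriv l d f + listDeriv l d g := by
  induction l with
  | nil => rfl
  | cons i l ih => rw [listDeriv_cons, ih, pderiv_iterate_add]; rfl

lemma listDeriv_mul_of_pderiv_eq_zero {n : ℕ} {l : List (Fin n)} (d : Expo n)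
    {f : MvPolynomial (Fin n) k} (hf : ∀ i ∈ l, pderiv i f = 0) (g : MvPolynomial (Fin n) k) :
    listDeriv l d (f * g) = f * listDeriv l d g := by
  induction l with
  | nil => rfl
  | cons i l ih =>
    rw [listDeriv_cons, ih (fun j hj => hf j (List.mem_cons_of_mem _ hj)),
      pderiv_iterate_mul_of_pderiv_eq_zero _ _ (hf i List.mem_cons_self)]
    rfl

lemma listDeriv_X_mul {n : ℕ} {l : List (Fin n)} (hl : l.Nodup) (d : Expo n) {i : Fin n}
    (hi : i ∈ l) (g : MvPolynomial (Fin n) k) :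
    listDeriv l d (X i * g) =
      X i * listDeriv l d g + d i • listDeriv l (d - Finsupp.single i 1) g := by
  induction l with
  | nil => simp at hi
  | cons j l ih =>
    rw [List.nodup_cons] at hl
    simp only [listDeriv_cons]
    by_cases hij : i = j
    · subst hij
      rw [listDeriv_mul_of_pderiv_eq_zero d (fun j hj => pderiv_X_of_ne ?_),
        pderiv_iterate_X_mul,
        listDeriv_congr (l := l) (d := d - Finsupp.single i 1) (e := d)]
      · simp
      · intro j hj
        have : i ≠ j := by rintro rfl; exact hl.1 hj
        simp [this]
      · rintro rfl; exact hl.1 hj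
    · have hil : i ∈ l := (List.mem_cons.1 hi).resolve_left hij
      rw [ih hl.2 hil, pderiv_iterate_add,
        pderiv_iterate_mul_of_pderiv_eq_zero _ _ (pderiv_X_of_ne hij), nsmul_eq_mul,
        pderiv_iterate_mul_of_pderiv_eq_zero _ _ (by simp), nsmul_eq_mul]
      simp [hij]

lemma mixedDeriv_add {n : ℕ} (d : Expo n) (f g : MvPolynomial (Fin n) k) :
    mixedDeriv d (f + g) = mixedDeriv d f + mixedDeriv d g :=
  listDeriv_add _ _ _ _

lemma mixedDeriv_zero {n : ℕ} (d : Expo n) : mixedDeriv d (0 : MvPolynomial (Fin n) k) = 0 :=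
  listDeriv_zero _ _

lemma mixedDeriv_C_mul {n : ℕ} (d : Expo n) (c : k) (f : MvPolynomial (Fin n) k) :
    mixedDeriv d (C c * f) = C c * mixedDeriv d f :=
  listDeriv_mul_of_pderiv_eq_zero _ (fun _ _ => pderiv_C) _

lemma mixedDeriv_X_mul {n : ℕ} (d : Expo n) (i : Fin n) (f : MvPolynomial (Fin n) k) :
    mixedDeriv d (X i * f) =
      X i * mixedDeriv d f + d i • mixedDeriv (d - Finsupp.single i 1) f :=
  listDeriv_X_mul (List.nodup_finRange n) _ (List.mem_finRange i) _

/-- For a lower set `D`, the polynomials whose derivatives in `D` vanish at `p` form an ideal. -/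
noncomputable def vanishingIdealAt {n : ℕ} (p : Fin n → k) (D : Finset (Expo n))
    (hD : IsLowerSet (D : Set (Expo n))) : Ideal (MvPolynomial (Fin n) k) where
  carrier := {f | ∀ d ∈ D, eval p (mixedDeriv d f) = 0}
  add_mem' {f g} hf hg d hd := by rw [mixedDeriv_add, map_add, hf d hd, hg d hd, add_zero]
  zero_mem' d _ := by rw [mixedDeriv_zero, map_zero]
  smul_mem' q f hf := by
    induction q using MvPolynomial.induction_on with
    | C c => intro d hd; rw [smul_eq_mul, mixedDeriv_C_mul, map_mul, hf d hd, mul_zero]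
    | add q r hq hr =>
      intro d hd
      rw [add_smul, mixedDeriv_add, map_add, hq d hd, hr d hd, add_zero]
    | mul_X q i hq =>
      intro d hd
      rw [smul_eq_mul, mul_comm q, mul_assoc, mixedDeriv_X_mul, map_add, map_mul, map_nsmul]
      have h₁ := hq d hd
      -- The Leibniz rule lowers `d` by one unit; this is the only place where the ideal property
      -- needs a lower set.
      have h₂ := hq (d - Finsupp.single i 1) (hD tsub_le_self hd)
      rw [smul_eq_mul] at h₁ h₂
      rw [h₁, h₂, mul_zero, smul_zero, add_zero]

lemma vanishesOn_iff {n : ℕ} {H : PointSet k n} (hH : H.IsValid) {f : MvPolynomial (Fin n) k} :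
    VanishesOn H f ↔ ∀ x (hx : x ∈ H), f ∈ vanishingIdealAt x.1 x.2 (hH.1 x hx) :=
  Iff.rfl

/-! ### The last variable -/

lemma pderiv_castSucc_lastSub {n : ℕ} (c : k) (i : Fin n) :
    pderiv i.castSucc (lastSub n c) = 0 := by
  rw [lastSub, map_sub, pderiv_C, pderiv_X_of_ne (Fin.castSucc_lt_last i).ne', sub_zero]

lemma pderiv_last_lastSub {n : ℕ} (c : k) : pderiv (Fin.last n) (lastSub n c) = 1 := by
  rw [lastSub, map_sub, pderiv_C, pderiv_X_self, sub_zero]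

lemma pderiv_last_rename {n : ℕ} (g : MvPolynomial (Fin n) k) :
    pderiv (Fin.last n) (rename Fin.castSucc g) = 0 := by
  apply pderiv_eq_zero_of_notMem_vars
  intro h
  classical
  obtain ⟨i, -, hi⟩ := Finset.mem_image.1 (vars_rename Fin.castSucc g h)
  exact (Fin.castSucc_lt_last i).ne hi

/-- The fold applies the derivatives in the last variable first. -/
lemma mixedDeriv_succ {n : ℕ} (d : Expo (n + 1)) (f : MvPolynomial (Fin (n + 1)) k) :
    mixedDeriv d f = listDeriv ((List.finRange n).map Fin.castSucc) d
      ((pderiv (Fin.last n))^[proj d] f) := by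
  rw [mixedDeriv, List.finRange_succ_last, List.foldr_append]
  rfl

lemma pderiv_iterate_rename {n : ℕ} (i : Fin n) (m : ℕ) (g : MvPolynomial (Fin n) k) :
    (pderiv i.castSucc)^[m] (rename Fin.castSucc g) =
      rename Fin.castSucc ((pderiv i)^[m] g) := by
  induction m generalizing g with
  | zero => rfl
  | succ m ih =>
    rw [Function.iterate_succ_apply, Function.iterate_succ_apply,
      pderiv_rename (Fin.castSucc_injective n), ih]

lemma listDeriv_map_castSucc_rename {n : ℕ} (d : Expo (n + 1)) (l : List (Fin n))
    (g : MvPolynomial (Fin n) k) :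
    listDeriv (l.map Fin.castSucc) d (rename Fin.castSucc g) =
      rename Fin.castSucc (listDeriv l (projHat d) g) := by
  induction l with
  | nil => rfl
  | cons i l ih =>
    rw [List.map_cons, listDeriv_cons, ih, pderiv_iterate_rename, listDeriv_cons, projHat_apply]

/-- Each differentiation costs at most one factor `Xₙ - c`. Divisibility rather than an explicit
derivative keeps this valid in every characteristic. -/
lemma lastSub_dvd_pderiv_iterate {n : ℕ} (c : k) (f : MvPolynomial (Fin (n + 1)) k) {m N : ℕ}
    (h : m < N) : lastSub n c ∣ (pderiv (Fin.last n))^[m] (lastSub n c ^ N * f) := by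
  induction m generalizing N f with
  | zero => exact Dvd.dvd.mul_right (dvd_pow_self _ (by omega)) _
  | succ m ih =>
    obtain ⟨N, rfl⟩ : ∃ M, N = M + 1 := ⟨N - 1, by omega⟩
    rw [Function.iterate_succ_apply, pderiv_mul, pderiv_pow, pderiv_last_lastSub, mul_one,
      Nat.add_sub_cancel]
    have : ((N + 1 : ℕ) : MvPolynomial (Fin (n + 1)) k) * lastSub n c ^ N * f +
        lastSub n c ^ (N + 1) * pderiv (Fin.last n) f =
        lastSub n c ^ N * (((N + 1 : ℕ) : MvPolynomial (Fin (n + 1)) k) * f +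
          lastSub n c * pderiv (Fin.last n) f) := by ring
    rw [this]
    exact ih _ (by omega)

lemma eval_lastSub {n : ℕ} (p : Fin (n + 1) → k) : eval p (lastSub n (p (Fin.last n))) = 0 := by
  simp [lastSub]

lemma pderiv_lastSub_of_mem_map {n : ℕ} (c : k) (j : ℕ) (l : List (Fin n)) :
    ∀ i ∈ l.map Fin.castSucc, pderiv i (lastSub n c ^ j) = 0 := by
  intro i hi
  obtain ⟨i, -, rfl⟩ := List.mem_map.1 hi
  rw [pderiv_pow, pderiv_castSucc_lastSub, mul_zero]

lemma eval_mixedDeriv_lastSub_pow_mul {n : ℕ} (p : Fin (n + 1) → k)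
    (f : MvPolynomial (Fin (n + 1)) k) {d : Expo (n + 1)} {N : ℕ} (h : proj d < N) :
    eval p (mixedDeriv d (lastSub n (p (Fin.last n)) ^ N * f)) = 0 := by
  rw [mixedDeriv_succ]
  obtain ⟨q, hq⟩ := lastSub_dvd_pderiv_iterate (p (Fin.last n)) f h
  have := listDeriv_mul_of_pderiv_eq_zero d
    (pderiv_lastSub_of_mem_map (p (Fin.last n)) 1 (List.finRange n)) q
  rw [pow_one] at this
  rw [hq, this, map_mul, eval_lastSub, zero_mul]

lemma pderiv_iterate_last_rename_mul {n : ℕ} (c : k) (g : MvPolynomial (Fin n) k) (i j : ℕ) :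
    (pderiv (Fin.last n))^[j] (rename Fin.castSucc g * lastSub n c ^ i) =
      rename Fin.castSucc g * ((i.descFactorial j : ℕ) * lastSub n c ^ (i - j)) := by
  rw [pderiv_iterate_mul_of_pderiv_eq_zero _ _ (pderiv_last_rename g)]
  congr 1
  induction j with
  | zero => simp
  | succ j ih =>
    rw [Function.iterate_succ_apply', ih, pderiv_mul, Derivation.map_natCast, zero_mul, zero_add,
      pderiv_pow, pderiv_last_lastSub, mul_one, Nat.descFactorial_succ, Nat.sub_sub, Nat.cast_mul]
    ring

lemma eval_mixedDeriv_rename_mul {n : ℕ} (p : Fin (n + 1) → k) (g : MvPolynomial (Fin n) k)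
    (d : Expo (n + 1)) (i : ℕ)
    (h : proj d = i → eval (fun j => p j.castSucc) (mixedDeriv (projHat d) g) = 0) :
    eval p (mixedDeriv d (rename Fin.castSucc g * lastSub n (p (Fin.last n)) ^ i)) = 0 := by
  -- Fewer than `i` derivatives in `Xₙ` leave a factor vanishing at `p`, more than `i` kill the
  -- power; only exactly `i` test `g` itself, up to the constant `i!`.
  rcases lt_trichotomy (proj d) i with hi | hi | hi
  · rw [mul_comm]
    exact eval_mixedDeriv_lastSub_pow_mul p _ hi
  · rw [mixedDeriv_succ, pderiv_iterate_last_rename_mul, hi, Nat.sub_self, pow_zero, mul_one,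
      mul_comm, listDeriv_mul_of_pderiv_eq_zero, listDeriv_map_castSucc_rename, map_mul,
      eval_rename]
    · have := h hi
      rw [mixedDeriv_eq_listDeriv] at this
      rw [Function.comp_def, this, mul_zero]
    · intro i _
      exact Derivation.map_natCast _ _
  · rw [mixedDeriv_succ, pderiv_iterate_last_rename_mul, Nat.descFactorial_of_lt hi,
      Nat.cast_zero, zero_mul, mul_zero, listDeriv_zero, map_zero]

end Derivatives

/-! ### Column heights -/

section Heights

variable {n : ℕ} {D D₁ D₂ : Finset (Expo (n + 1))}

lemma columnHeight_eq {h : Expo n → ℕ} (hD : ∀ d, d ∈ D ↔ proj d < h (projHat d)) (a : Expo n) :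
    columnHeight D a = h a := by
  have : D.filter (fun d => projHat d = a) = (Finset.range (h a)).image (embed · a) := by
    ext d
    simp only [Finset.mem_filter, Finset.mem_image, Finset.mem_range]
    constructor
    · rintro ⟨hd, rfl⟩
      exact ⟨proj d, (hD d).1 hd, embed_proj_projHat d⟩
    · rintro ⟨r, hr, rfl⟩
      exact ⟨(hD _).2 (by simpa using hr), projHat_embed _ _⟩
  rw [columnHeight, this, Finset.card_image_of_injective, Finset.card_range]
  intro r s hrs
  simpa using congrArg proj hrs

lemma exists_embed_notMem (D : Finset (Expo (n + 1))) (a : Expo n) : ∃ r, embed r a ∉ D := by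
  refine ⟨D.sup proj + 1, fun h => ?_⟩
  have : proj (embed (D.sup proj + 1) a) ≤ D.sup proj := Finset.le_sup h
  rw [proj_embed] at this
  omega

lemma mem_iff_lt_sInf (hD : IsLowerSet (D : Set (Expo (n + 1)))) (d : Expo (n + 1)) :
    d ∈ D ↔ proj d < sInf {r : ℕ | embed r (projHat d) ∉ D} := by
  constructor
  · intro hd
    by_contra! hcon
    refine Nat.sInf_mem (exists_embed_notMem D (projHat d)) (hD (expo_le_iff.2 ⟨?_, ?_⟩) hd)
    · rw [projHat_embed]
    · rwa [proj_embed]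
  · intro hd
    by_contra hcon
    exact Nat.notMem_of_lt_sInf hd (by simpa using hcon)

lemma columnHeight_eq_sInf (hD : IsLowerSet (D : Set (Expo (n + 1)))) (a : Expo n) :
    columnHeight D a = sInf {r : ℕ | embed r a ∉ D} :=
  columnHeight_eq (h := fun a => sInf {r : ℕ | embed r a ∉ D}) (mem_iff_lt_sInf hD) a

/-- With antitonicity below, this replaces lower sets by their height functions, on which addition
is pointwise. -/
lemma mem_iff_lt_columnHeight (hD : IsLowerSet (D : Set (Expo (n + 1)))) {d : Expo (n + 1)} :
    d ∈ D ↔ proj d < columnHeight D (projHat d) := by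
  rw [columnHeight_eq_sInf hD, mem_iff_lt_sInf hD]

lemma glt_eq (hD : IsLowerSet (D : Set (Expo (n + 1)))) (a : Expo (n + 1)) :
    glt a D = embed (columnHeight D (projHat a)) (projHat a) := by
  rw [columnHeight_eq_sInf hD, glt]

lemma columnHeight_anti (hD : IsLowerSet (D : Set (Expo (n + 1)))) :
    Antitone (columnHeight D) := by
  intro a b hab
  by_contra! hlt
  have : embed (columnHeight D a) b ∈ D := (mem_iff_lt_columnHeight hD).2 (by simpa using hlt)
  have : embed (columnHeight D a) a ∈ D := hD (expo_le_iff.2 ⟨by simpa using hab, by simp⟩) this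
  rw [mem_iff_lt_columnHeight hD] at this
  simp at this

lemma isLowerSet_of_mem_iff {h : Expo n → ℕ} (hh : Antitone h)
    (hD : ∀ d, d ∈ D ↔ proj d < h (projHat d)) : IsLowerSet (D : Set (Expo (n + 1))) := by
  intro a b hba ha
  rw [Finset.mem_coe, hD] at *
  rw [expo_le_iff] at hba
  have := hh hba.1
  omega

lemma subset_iff_columnHeight_le (h₁ : IsLowerSet (D₁ : Set (Expo (n + 1))))
    (h₂ : IsLowerSet (D₂ : Set (Expo (n + 1)))) :
    D₁ ⊆ D₂ ↔ ∀ a, columnHeight D₁ a ≤ columnHeight D₂ a := by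
  constructor
  · intro h a
    exact Finset.card_le_card (Finset.filter_subset_filter _ h)
  · intro h d hd
    rw [mem_iff_lt_columnHeight h₁] at hd
    rw [mem_iff_lt_columnHeight h₂]
    exact hd.trans_le (h _)

lemma eq_of_columnHeight_eq (h₁ : IsLowerSet (D₁ : Set (Expo (n + 1))))
    (h₂ : IsLowerSet (D₂ : Set (Expo (n + 1))))
    (h : ∀ a, columnHeight D₁ a = columnHeight D₂ a) : D₁ = D₂ :=
  Finset.Subset.antisymm ((subset_iff_columnHeight_le h₁ h₂).2 fun a => (h a).le)
    ((subset_iff_columnHeight_le h₂ h₁).2 fun a => (h a).ge)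

lemma mem_addLower_iff (h₁ : IsLowerSet (D₁ : Set (Expo (n + 1))))
    (h₂ : IsLowerSet (D₂ : Set (Expo (n + 1)))) (d : Expo (n + 1)) :
    d ∈ addLower D₁ D₂ ↔
      proj d < columnHeight D₁ (projHat d) + columnHeight D₂ (projHat d) := by
  rw [addLower, Finset.mem_union, Finset.mem_image, mem_iff_lt_columnHeight h₁]
  constructor
  · rintro (h | ⟨e, he, rfl⟩)
    · omega
    · rw [mem_iff_lt_columnHeight h₂] at he
      simpa using he
  · intro h
    by_cases hd : proj d < columnHeight D₁ (projHat d)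
    · exact Or.inl hd
    · refine Or.inr ⟨embed (proj d - columnHeight D₁ (projHat d)) (projHat d), ?_, ?_⟩
      · rw [mem_iff_lt_columnHeight h₂]
        simp only [proj_embed, projHat_embed]
        omega
      · exact expo_ext (by simp) (by simp only [proj_embed, projHat_embed]; omega)

lemma columnHeight_addLower (h₁ : IsLowerSet (D₁ : Set (Expo (n + 1))))
    (h₂ : IsLowerSet (D₂ : Set (Expo (n + 1)))) (a : Expo n) :
    columnHeight (addLower D₁ D₂) a = columnHeight D₁ a + columnHeight D₂ a :=
  columnHeight_eq (h := fun a => columnHeight D₁ a + columnHeight D₂ a) (mem_addLower_iff h₁ h₂) a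

lemma isLowerSet_addLower (h₁ : IsLowerSet (D₁ : Set (Expo (n + 1))))
    (h₂ : IsLowerSet (D₂ : Set (Expo (n + 1)))) :
    IsLowerSet (addLower D₁ D₂ : Set (Expo (n + 1))) :=
  isLowerSet_of_mem_iff
    (fun _ _ h => add_le_add (columnHeight_anti h₁ h) (columnHeight_anti h₂ h))
    (mem_addLower_iff h₁ h₂)

lemma foldl_addLower {ι : Type*} {f : ι → Finset (Expo (n + 1))} (l : List ι)
    (hf : ∀ c ∈ l, IsLowerSet (f c : Set (Expo (n + 1))))
    (hD : IsLowerSet (D : Set (Expo (n + 1)))) :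
    IsLowerSet ((l.foldl (fun D c => addLower D (f c)) D : Finset (Expo (n + 1))) :
      Set (Expo (n + 1))) ∧
      ∀ a, columnHeight (l.foldl (fun D c => addLower D (f c)) D) a =
        columnHeight D a + (l.map fun c => columnHeight (f c) a).sum := by
  induction l generalizing D with
  | nil => exact ⟨hD, fun a => by simp⟩
  | cons c l ih =>
    have hc := hf c List.mem_cons_self
    obtain ⟨h₁, h₂⟩ := ih (fun b hb => hf b (List.mem_cons_of_mem _ hb))
      (isLowerSet_addLower hD hc)
    refine ⟨h₁, fun a => ?_⟩
    rw [List.foldl_cons, h₂, columnHeight_addLower hD hc, List.map_cons, List.sum_cons, add_assoc]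

lemma columnHeight_empty (a : Expo n) : columnHeight (∅ : Finset (Expo (n + 1))) a = 0 := rfl

/-- Lying outside `D` forces the last entry up to the height; having its lower neighbour in `D`
forbids anything more. -/
lemma proj_eq_of_mem_limitingSet (hD : IsLowerSet (D : Set (Expo (n + 1)))) {a : Expo (n + 1)}
    (ha : a ∈ limitingSet D) : proj a = columnHeight D (projHat a) := by
  refine le_antisymm ?_ (not_lt.1 fun h => ha.1 ((mem_iff_lt_columnHeight hD).2 h))
  by_contra! hlt
  have := ha.2 (Fin.last n) (by change proj a ≠ 0; omega)
  rw [mem_iff_lt_columnHeight hD] at this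
  simp at this
  omega

end Heights

/-! ### The lower set of a set of points -/

section LowerSet

variable {k : Type*}

/-- Each point of `H` is a point of `H'` with at least the same multiplicity structure. -/
def PointSet.Refines {n : ℕ} (H H' : PointSet k n) : Prop :=
  ∀ x ∈ H, ∃ y ∈ H', x.1 = y.1 ∧ x.2 ⊆ y.2

lemma mem_fibre {n : ℕ} {H : PointSet k (n + 1)} {c : k}
    {x : (Fin (n + 1) → k) × Finset (Expo (n + 1))} :
    x ∈ fibre H c ↔ x ∈ H ∧ x.1 (Fin.last n) = c := by
  classical
  simp [fibre]

lemma mem_lastCoords {n : ℕ} {H : PointSet k (n + 1)} {c : k} :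
    c ∈ lastCoords H ↔ ∃ x ∈ H, x.1 (Fin.last n) = c := by
  classical
  simp [lastCoords]

lemma PointSet.IsValid.fibre {n : ℕ} {H : PointSet k (n + 1)} (hH : H.IsValid) (c : k) :
    (fibre H c).IsValid :=
  ⟨fun x hx => hH.1 x (mem_fibre.1 hx).1,
    fun x hx y hy => hH.2 x (mem_fibre.1 hx).1 y (mem_fibre.1 hy).1⟩

lemma mem_slice {n : ℕ} {H : PointSet k (n + 1)} {i : ℕ} {y : (Fin n → k) × Finset (Expo n)} :
    y ∈ slice H i ↔ y.2.Nonempty ∧ ∃ x ∈ H, y.1 = (fun j => x.1 j.castSucc) ∧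
      ∀ d, d ∈ y.2 ↔ embed i d ∈ x.2 := by
  classical
  have key (D : Finset (Expo (n + 1))) (d : Expo n) :
      d ∈ (D.filter (fun d => proj d = i)).image projHat ↔ embed i d ∈ D := by
    simp only [Finset.mem_image, Finset.mem_filter]
    constructor
    · rintro ⟨e, ⟨he, rfl⟩, rfl⟩
      simpa using he
    · intro h
      exact ⟨_, ⟨h, proj_embed _ _⟩, projHat_embed _ _⟩
  rw [slice, Finset.mem_filter, Finset.mem_image, and_comm]
  refine and_congr_right fun _ => exists_congr fun x => and_congr_right fun _ => ?_
  constructor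
  · rintro rfl
    exact ⟨rfl, fun d => by convert key x.2 d⟩
  · rintro ⟨h₁, h₂⟩
    refine Prod.ext h₁.symm (Finset.ext fun d => ?_)
    rw [h₂, ← key x.2 d]

lemma lt_levels_of_mem {n : ℕ} {H : PointSet k (n + 1)}
    {x : (Fin (n + 1) → k) × Finset (Expo (n + 1))}
    (hx : x ∈ H) {d : Expo (n + 1)} (hd : d ∈ x.2) : proj d < levels H := by
  have h₁ : x.2.sup (fun d => proj d + 1) ≤ levels H :=
    Finset.le_sup (f := fun x : (Fin (n + 1) → k) × Finset (Expo (n + 1)) =>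
      x.2.sup (fun d => proj d + 1)) hx
  have h₂ := Finset.le_sup (f := fun d : Expo (n + 1) => proj d + 1) hd
  omega

lemma exists_of_lt_levels {n : ℕ} {H : PointSet k (n + 1)} {i : ℕ} (hi : i < levels H) :
    ∃ x ∈ H, ∃ d ∈ x.2, i ≤ proj d := by
  obtain ⟨x, hx, hi⟩ := (Finset.lt_sup_iff (a := i)).1 hi
  obtain ⟨d, hd, hi⟩ := (Finset.lt_sup_iff (a := i)).1 hi
  exact ⟨x, hx, d, hd, by omega⟩

/-- A point reaching the top level has functionals at all levels below, its multiplicity structure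
being a lower set. Nonemptiness is required by the induction hypothesis. -/
lemma slice_nonempty {n : ℕ} {H : PointSet k (n + 1)} (hH : H.IsValid) {i : ℕ}
    (hi : i < levels H) : (slice H i).Nonempty := by
  classical
  obtain ⟨x, hx, d, hd, hid⟩ := exists_of_lt_levels hi
  have hmem : embed i (projHat d) ∈ x.2 :=
    hH.1 x hx (expo_le_iff.2 ⟨by simp, by simpa using hid⟩) hd
  refine ⟨((fun j => x.1 (Fin.castSucc j) : Fin n → k),
    (x.2.filter (fun d => proj d = i)).image projHat), ?_⟩
  rw [slice, Finset.mem_filter]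
  refine ⟨Finset.mem_image.2 ⟨x, hx, by congr!⟩, projHat d, ?_⟩
  exact Finset.mem_image.2 ⟨_, Finset.mem_filter.2 ⟨hmem, proj_embed _ _⟩, projHat_embed _ _⟩

lemma PointSet.IsValid.slice {n : ℕ} {H : PointSet k (n + 1)} (hH : H.IsValid) {c : k}
    (hc : ∀ x ∈ H, x.1 (Fin.last n) = c) (i : ℕ) : (slice H i).IsValid := by
  constructor
  · intro y hy a b hba ha
    obtain ⟨-, x, hx, -, h⟩ := mem_slice.1 hy
    rw [Finset.mem_coe, h] at *
    exact hH.1 x hx (expo_le_iff.2 ⟨by simpa using hba, by simp⟩) ha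
  · intro y hy y' hy' hyy
    obtain ⟨-, x, hx, h₁, h₂⟩ := mem_slice.1 hy
    obtain ⟨-, x', hx', h₁', h₂'⟩ := mem_slice.1 hy'
    have : x = x' := by
      refine hH.2 x hx x' hx' (funext fun j => ?_)
      induction j using Fin.lastCases with
      | last => rw [hc x hx, hc x' hx']
      | cast j => exact congrFun (h₁.symm.trans (hyy.trans h₁')) j
    subst this
    exact Prod.ext hyy (Finset.ext fun d => by rw [h₂, h₂'])

lemma exists_mem_slice {n : ℕ} {H : PointSet k (n + 1)}
    {x : (Fin (n + 1) → k) × Finset (Expo (n + 1))} (hx : x ∈ H) {i : ℕ} {d : Expo n}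
    (hd : embed i d ∈ x.2) :
    ∃ y ∈ slice H i, y.1 = (fun j => x.1 j.castSucc) ∧ ∀ d, d ∈ y.2 ↔ embed i d ∈ x.2 := by
  classical
  have key (d : Expo n) : d ∈ (x.2.filter (fun d => proj d = i)).image projHat ↔
      embed i d ∈ x.2 := by
    simp only [Finset.mem_image, Finset.mem_filter]
    constructor
    · rintro ⟨e, ⟨he, rfl⟩, rfl⟩
      simpa using he
    · intro h
      exact ⟨_, ⟨h, proj_embed _ _⟩, projHat_embed _ _⟩
  exact ⟨(_, (x.2.filter (fun d => proj d = i)).image projHat),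
    mem_slice.2 ⟨⟨d, (key d).2 hd⟩, x, hx, rfl, key⟩, rfl, key⟩

/-- Slices shrink as the level rises, because multiplicity structures are closed downwards along the
last axis. -/
lemma refines_slice {n : ℕ} {H H' : PointSet k (n + 1)} (hH : H.IsValid) (h : H.Refines H')
    {i j : ℕ} (hij : i ≤ j) : (slice H j).Refines (slice H' i) := by
  intro y hy
  obtain ⟨⟨d, hd⟩, x, hx, h₁, h₂⟩ := mem_slice.1 hy
  obtain ⟨x', hx', hxx, hsub⟩ := h x hx
  have key (e : Expo n) (he : e ∈ y.2) : embed i e ∈ x'.2 :=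
    hsub (hH.1 x hx (expo_le_iff.2 ⟨by simp, by simpa using hij⟩) ((h₂ e).1 he))
  obtain ⟨y', hy', h₁', h₂'⟩ := exists_mem_slice hx' (key d hd)
  exact ⟨y', hy', by rw [h₁, h₁', hxx], fun e he => (h₂' e).2 (key e he)⟩

lemma PointSet.Refines.refl {n : ℕ} (H : PointSet k n) : H.Refines H :=
  fun x hx => ⟨x, hx, rfl, Finset.Subset.refl _⟩

lemma PointSet.Refines.fibre {n : ℕ} {H H' : PointSet k (n + 1)} (h : H.Refines H') (c : k) :
    (PointIdeal.fibre H c).Refines (PointIdeal.fibre H' c) := by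
  intro x hx
  obtain ⟨hx, hc⟩ := mem_fibre.1 hx
  obtain ⟨y, hy, hxy, hsub⟩ := h x hx
  exact ⟨y, mem_fibre.2 ⟨hy, by rw [← hxy, hc]⟩, hxy, hsub⟩

lemma PointSet.Refines.levels_le {n : ℕ} {H H' : PointSet k (n + 1)} (h : H.Refines H') :
    levels H ≤ levels H' := by
  by_contra! hlt
  obtain ⟨x, hx, d, hd, hle⟩ := exists_of_lt_levels hlt
  obtain ⟨y, hy, -, hsub⟩ := h x hx
  have := lt_levels_of_mem hy (hsub hd)
  omega

lemma PointSet.Refines.lastCoords_subset {n : ℕ} {H H' : PointSet k (n + 1)} (h : H.Refines H') :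
    lastCoords H ⊆ lastCoords H' := by
  intro c hc
  obtain ⟨x, hx, hc⟩ := mem_lastCoords.1 hc
  obtain ⟨y, hy, hxy, -⟩ := h x hx
  exact mem_lastCoords.2 ⟨y, hy, by rw [← hxy, hc]⟩

lemma mem_specialLowerSet {n : ℕ} {DD : PointSet k n → Finset (Expo n)} {H : PointSet k (n + 1)}
    {d : Expo (n + 1)} :
    d ∈ specialLowerSet DD H ↔ proj d < levels H ∧ projHat d ∈ DD (slice H (proj d)) := by
  simp only [specialLowerSet, Finset.mem_biUnion, Finset.mem_range, Finset.mem_image]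
  constructor
  · rintro ⟨i, hi, e, he, rfl⟩
    simpa using ⟨hi, he⟩
  · rintro ⟨h₁, h₂⟩
    exact ⟨_, h₁, _, h₂, embed_proj_projHat d⟩

lemma columnHeight_special_le_levels {n : ℕ} {DD : PointSet k n → Finset (Expo n)}
    {H : PointSet k (n + 1)} (hD : IsLowerSet (specialLowerSet DD H : Set (Expo (n + 1))))
    (μ : Expo n) : columnHeight (specialLowerSet DD H) μ ≤ levels H := by
  by_contra! hlt
  have : embed (levels H) μ ∈ specialLowerSet DD H := by
    rw [mem_iff_lt_columnHeight hD]
    simpa using hlt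
  simp [mem_specialLowerSet] at this

lemma projHat_mem_limitingSet {n : ℕ} {DD : PointSet k n → Finset (Expo n)} {H : PointSet k (n + 1)}
    {a : Expo (n + 1)} (ha : a ∈ limitingSet (specialLowerSet DD H)) (hlt : proj a < levels H) :
    projHat a ∈ limitingSet (DD (slice H (proj a))) := by
  refine ⟨fun h => ha.1 (mem_specialLowerSet.2 ⟨hlt, h⟩), fun j hj => ?_⟩
  simpa using (mem_specialLowerSet.1 (ha.2 j.castSucc hj)).2

lemma projHat_eq_zero_of_levels_le {n : ℕ} {DD : PointSet k n → Finset (Expo n)}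
    {H : PointSet k (n + 1)} {a : Expo (n + 1)}
    (ha : a ∈ limitingSet (specialLowerSet DD H)) (hle : levels H ≤ proj a) : projHat a = 0 := by
  ext j
  by_contra hj
  have := (mem_specialLowerSet.1 (ha.2 j.castSucc hj)).1
  rw [proj_sub, proj_single_castSucc] at this
  omega

/-! ### Monotonicity of `D(H)` under refinement -/

/-- `DD` assigns lower sets to valid sets of points, monotonically with respect to refinement. -/
structure IsMonotoneLower {n : ℕ} (DD : PointSet k n → Finset (Expo n)) : Prop where
  isLowerSet {H : PointSet k n} : H.IsValid → IsLowerSet (DD H : Set (Expo n))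
  subset {H H' : PointSet k n} : H.IsValid → H'.IsValid → H.Refines H' → DD H ⊆ DD H'

variable {n : ℕ} {DD : PointSet k n → Finset (Expo n)}

/-- Higher slices refine lower ones, so stacking their lower sets is again a lower set exactly
because `DD` is monotone. This is why the induction carries monotonicity along. -/
lemma IsMonotoneLower.isLowerSet_special (hDD : IsMonotoneLower DD) {H : PointSet k (n + 1)}
    (hH : H.IsValid) {c : k} (hc : ∀ x ∈ H, x.1 (Fin.last n) = c) :
    IsLowerSet (specialLowerSet DD H : Set (Expo (n + 1))) := by
  intro a b hba ha
  rw [Finset.mem_coe, mem_specialLowerSet] at *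
  rw [expo_le_iff] at hba
  refine ⟨hba.2.trans_lt ha.1, ?_⟩
  exact hDD.subset (hH.slice hc _) (hH.slice hc _) (refines_slice hH (.refl H) hba.2)
    (hDD.isLowerSet (hH.slice hc _) hba.1 ha.2)

lemma IsMonotoneLower.special_subset (hDD : IsMonotoneLower DD) {H H' : PointSet k (n + 1)}
    (hH : H.IsValid) (hH' : H'.IsValid) {c : k} (hc : ∀ x ∈ H, x.1 (Fin.last n) = c)
    (hc' : ∀ x ∈ H', x.1 (Fin.last n) = c) (h : H.Refines H') :
    specialLowerSet DD H ⊆ specialLowerSet DD H' := by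
  intro a ha
  rw [mem_specialLowerSet] at *
  exact ⟨ha.1.trans_le h.levels_le,
    hDD.subset (hH.slice hc _) (hH'.slice hc' _) (refines_slice hH h le_rfl) ha.2⟩

lemma fibre_last (H : PointSet k (n + 1)) (c : k) : ∀ x ∈ fibre H c, x.1 (Fin.last n) = c :=
  fun _ hx => (mem_fibre.1 hx).2

lemma IsMonotoneLower.isLowerSet_special_fibre (hDD : IsMonotoneLower DD)
    {H : PointSet k (n + 1)} (hH : H.IsValid) (c : k) :
    IsLowerSet (specialLowerSet DD (fibre H c) : Set (Expo (n + 1))) :=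
  hDD.isLowerSet_special (hH.fibre c) (fibre_last H c)

lemma foldl_special (hDD : IsMonotoneLower DD) {H : PointSet k (n + 1)} (hH : H.IsValid) :
    IsLowerSet (((lastCoords H).toList.foldl
      (fun D c => addLower D (specialLowerSet DD (fibre H c))) ∅ : Finset (Expo (n + 1))) :
        Set (Expo (n + 1))) ∧
    ∀ a, columnHeight ((lastCoords H).toList.foldl
      (fun D c => addLower D (specialLowerSet DD (fibre H c))) ∅) a =
        ∑ c ∈ lastCoords H, columnHeight (specialLowerSet DD (fibre H c)) a := by
  obtain ⟨h₁, h₂⟩ := foldl_addLower (D := ∅) (f := fun c => specialLowerSet DD (fibre H c))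
    (lastCoords H).toList (fun c _ => hDD.isLowerSet_special_fibre hH c)
    (by rw [Finset.coe_empty]; exact isLowerSet_empty)
  refine ⟨h₁, fun a => ?_⟩
  rw [h₂, columnHeight_empty, zero_add, Finset.sum_map_toList]

lemma mem_lowerSetOf_zero {H : PointSet k 1} {d : Expo 1} :
    d ∈ lowerSetOf 0 H ↔ proj d < ∑ x ∈ H, x.2.card := by
  rw [lowerSetOf, Finset.mem_image]
  constructor
  · rintro ⟨r, hr, rfl⟩
    simpa [proj] using hr
  · intro h
    refine ⟨proj d, Finset.mem_range.2 h, ?_⟩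
    exact expo_ext (Finsupp.ext fun i => i.elim0) (by simp [proj])

lemma isMonotoneLower_lowerSetOf (n : ℕ) : IsMonotoneLower (lowerSetOf (k := k) n) := by
  induction n with
  | zero =>
    constructor
    · intro H hH
      exact isLowerSet_of_mem_iff (h := fun _ => ∑ x ∈ H, x.2.card) antitone_const
        (fun d => mem_lowerSetOf_zero)
    · intro H H' hH hH' h d hd
      classical
      rw [mem_lowerSetOf_zero] at *
      refine hd.trans_le ?_
      -- `φ` keeps the point, and points of `H` are distinct, so it is injective on `H` and the
      -- total multiplicity can only grow.
      choose! φ h₁ h₂ h₃ using h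
      calc ∑ x ∈ H, x.2.card ≤ ∑ x ∈ H, (φ x).2.card :=
            Finset.sum_le_sum fun x hx => Finset.card_le_card (h₃ x hx)
        _ = ∑ y ∈ H.image φ, y.2.card := by
            rw [Finset.sum_image]
            intro x hx y hy hxy
            exact hH.2 x hx y hy (by rw [h₂ x hx, h₂ y hy, hxy])
        _ ≤ ∑ y ∈ H', y.2.card :=
            Finset.sum_le_sum_of_subset (Finset.image_subset_iff.2 h₁)
  | succ n ih =>
    constructor
    · intro H hH
      exact (foldl_special ih hH).1
    · intro H H' hH hH' h
      refine (subset_iff_columnHeight_le (foldl_special ih hH).1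
        (foldl_special ih hH').1).2 fun a => ?_
      rw [(foldl_special ih hH).2, (foldl_special ih hH').2]
      refine (Finset.sum_le_sum fun c _ => ?_).trans
        (Finset.sum_le_sum_of_subset h.lastCoords_subset)
      exact (subset_iff_columnHeight_le (ih.isLowerSet_special_fibre hH c)
        (ih.isLowerSet_special_fibre hH' c)).1 (ih.special_subset (hH.fibre c) (hH'.fibre c)
          (fibre_last H c) (fibre_last H' c) (h.fibre c)) a

lemma isLowerSet_lowerSetOf {n : ℕ} {H : PointSet k (n + 1)} (hH : H.IsValid) :
    IsLowerSet (lowerSetOf n H : Set (Expo (n + 1))) :=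
  (isMonotoneLower_lowerSetOf n).isLowerSet hH

/-- Heights are an unordered sum over the fibres, so `D(H)` does not depend on the order in which
the fibres are added. -/
lemma columnHeight_lowerSetOf_succ {n : ℕ} {H : PointSet k (n + 2)} (hH : H.IsValid)
    (a : Expo (n + 1)) :
    columnHeight (lowerSetOf (n + 1) H) a =
      ∑ c ∈ lastCoords H, columnHeight (specialLowerSet (lowerSetOf n) (fibre H c)) a :=
  (foldl_special (isMonotoneLower_lowerSetOf n) hH).2 a

end LowerSet

section HatLead

variable {k : Type*} [Field k] {n : ℕ}

/-! ### Leading coefficients with respect to the first variables -/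

/-- The polynomials all of whose terms have an exponent `m` with `projHat m` below `μ`. -/
noncomputable def hatBelow (k : Type*) [Field k] {n : ℕ} (μ : Expo n) :
    Submodule k (MvPolynomial (Fin (n + 1)) k) :=
  restrictSupport k {m | lexLT (projHat m) μ}

lemma mem_hatBelow {μ : Expo n} {f : MvPolynomial (Fin (n + 1)) k} :
    f ∈ hatBelow k μ ↔ ∀ m ∈ f.support, lexLT (projHat m) μ :=
  mem_restrictSupport_iff k

/-- As a polynomial in the first `n` variables over `k[Xₙ]`, the polynomial `f` is `p • X^μ` plus
lower terms. -/
def HatLead (f : MvPolynomial (Fin (n + 1)) k) (μ : Expo n) (p : Polynomial k) : Prop :=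
  f - monomial (embed 0 μ) 1 * inLast n p ∈ hatBelow k μ

lemma inLast_mul (p q : Polynomial k) : inLast n (p * q) = inLast n p * inLast n q :=
  map_mul _ _ _

lemma inLast_add (p q : Polynomial k) : inLast n (p + q) = inLast n p + inLast n q :=
  map_add _ _ _

lemma inLast_one : inLast n (1 : Polynomial k) = 1 := map_one _

lemma inLast_X_sub_C_pow (c : k) (i : ℕ) :
    inLast n ((Polynomial.X - Polynomial.C c) ^ i) = lastSub n c ^ i := by
  simp [inLast, lastSub, algebraMap_eq]

lemma inLast_prod {ι : Type*} (s : Finset ι) (p : ι → Polynomial k) :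
    inLast n (∏ i ∈ s, p i) = ∏ i ∈ s, inLast n (p i) :=
  map_prod _ _ _

lemma inLast_monomial (j : ℕ) (a : k) :
    inLast n (Polynomial.monomial j a) = monomial (embed j 0) a := by
  rw [inLast, Polynomial.aeval_monomial, algebraMap_eq, C_mul_X_pow_eq_monomial]
  simp [embed]

lemma coeff_monomial_mul_inLast (μ : Expo n) (p : Polynomial k) (m : Expo (n + 1)) :
    coeff m (monomial (embed 0 μ) 1 * inLast n p) =
      if projHat m = μ then p.coeff (proj m) else 0 := by
  induction p using Polynomial.induction_on' with
  | add p q hp hq =>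
    rw [inLast_add, mul_add, coeff_add, hp, hq]
    split_ifs <;> simp
  | monomial j a =>
    rw [inLast_monomial, monomial_mul, one_mul, coeff_monomial, Polynomial.coeff_monomial]
    have : embed 0 μ + embed j 0 = m ↔ projHat m = μ ∧ j = proj m := by
      constructor
      · rintro rfl
        simp
      · rintro ⟨rfl, rfl⟩
        exact expo_ext (by simp) (by simp)
    simp only [this]
    split_ifs <;> simp_all

/-- A factor in `k[Xₙ]` moves exponents only within their columns. -/
lemma exists_of_mem_support_mul_inLast {f : MvPolynomial (Fin (n + 1)) k} {p : Polynomial k}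
    {m : Expo (n + 1)} (hm : m ∈ (f * inLast n p).support) :
    ∃ e ∈ f.support, projHat m = projHat e ∧ proj m ≤ proj e + p.natDegree := by
  classical
  obtain ⟨e, he, e', he', rfl⟩ := Finset.mem_add.1 (support_mul _ _ hm)
  have h := coeff_monomial_mul_inLast (0 : Expo n) p e'
  have h₀ : embed 0 (0 : Expo n) = 0 := by simp [embed]
  rw [h₀, monomial_zero', C_1, one_mul] at h
  rw [mem_support_iff, h] at he'
  split_ifs at he' with h'
  · refine ⟨e, he, by simp [h'], ?_⟩
    rw [proj_add]
    exact Nat.add_le_add_left (Polynomial.le_natDegree_of_ne_zero he') _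
  · exact absurd rfl he'

lemma mul_inLast_mem_hatBelow {μ : Expo n} {f : MvPolynomial (Fin (n + 1)) k}
    (hf : f ∈ hatBelow k μ) (p : Polynomial k) : f * inLast n p ∈ hatBelow k μ := by
  rw [mem_hatBelow] at *
  intro m hm
  obtain ⟨e, he, hme, -⟩ := exists_of_mem_support_mul_inLast hm
  rw [hme]
  exact hf e he

lemma HatLead.mul_inLast {f : MvPolynomial (Fin (n + 1)) k} {μ : Expo n} {p : Polynomial k}
    (h : HatLead f μ p) (q : Polynomial k) : HatLead (f * inLast n q) μ (p * q) := by
  have := mul_inLast_mem_hatBelow h q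
  rwa [sub_mul, mul_assoc, ← inLast_mul] at this

lemma HatLead.add {f g : MvPolynomial (Fin (n + 1)) k} {μ : Expo n} {p q : Polynomial k}
    (hf : HatLead f μ p) (hg : HatLead g μ q) : HatLead (f + g) μ (p + q) := by
  have := add_mem hf hg
  rwa [sub_add_sub_comm, ← mul_add, ← inLast_add] at this

lemma HatLead.sub_mem {f g : MvPolynomial (Fin (n + 1)) k} {μ : Expo n} {p : Polynomial k}
    (hf : HatLead f μ p) (hg : g ∈ hatBelow k μ) : HatLead (f - g) μ p := by
  have := Submodule.sub_mem _ hf hg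
  rwa [sub_right_comm] at this

lemma HatLead.mul_monomial {f : MvPolynomial (Fin (n + 1)) k} {μ : Expo n} {p : Polynomial k}
    (hf : HatLead f μ p) (ν : Expo n) :
    HatLead (f * monomial (embed 0 ν) 1) (μ + ν) p := by
  have h : f * monomial (embed 0 ν) 1 - monomial (embed 0 (μ + ν)) 1 * inLast n p =
      (f - monomial (embed 0 μ) 1 * inLast n p) * monomial (embed 0 ν) 1 := by
    have : embed 0 (μ + ν) = embed 0 μ + embed 0 ν := expo_ext (by simp) (by simp)
    rw [this, ← mul_one (1 : k), ← monomial_mul, mul_one]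
    ring
  rw [HatLead, h, mem_hatBelow]
  intro m hm
  classical
  obtain ⟨e, he, e', he', rfl⟩ := Finset.mem_add.1 (support_mul _ _ hm)
  rw [Finset.mem_singleton.1 (support_monomial_subset he'), projHat_add, projHat_embed,
    add_comm, add_comm μ]
  exact (mem_hatBelow.1 hf e he).add_left ν

lemma HatLead.coeff_embed {f : MvPolynomial (Fin (n + 1)) k} {μ : Expo n} {p : Polynomial k}
    (hf : HatLead f μ p) (r : ℕ) : coeff (embed r μ) f = p.coeff r := by
  have h : coeff (embed r μ) (f - monomial (embed 0 μ) 1 * inLast n p) = 0 := by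
    by_contra hne
    have := mem_hatBelow.1 hf _ (mem_support_iff.2 hne)
    rw [projHat_embed] at this
    exact lexLT_irrefl _ this
  rw [coeff_sub, coeff_monomial_mul_inLast, sub_eq_zero] at h
  simpa using h

/-- Terms over `μ` are bounded by the degree of `p`; all other terms have a smaller projection. -/
lemma HatLead.of_mem_support {f : MvPolynomial (Fin (n + 1)) k} {μ : Expo n} {p : Polynomial k}
    (hf : HatLead f μ p) {m : Expo (n + 1)} (hm : m ∈ f.support) :
    lexLT m (embed p.natDegree μ) ∨ m = embed p.natDegree μ := by
  by_cases hμ : projHat m = μ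
  · subst hμ
    rw [mem_support_iff, ← embed_proj_projHat m, hf.coeff_embed] at hm
    rcases (Polynomial.le_natDegree_of_ne_zero hm).lt_or_eq with h | h
    · exact Or.inl (lexLT_succ_iff.2 (Or.inr (by simpa using h)))
    · exact Or.inr (by rw [← h, embed_proj_projHat])
  · refine Or.inl (lexLT_succ_iff.2 (Or.inl ?_))
    rw [projHat_embed]
    refine mem_hatBelow.1 hf m ?_
    rw [mem_support_iff, coeff_sub, coeff_monomial_mul_inLast, if_neg hμ, sub_zero]
    exact mem_support_iff.1 hm

lemma HatLead.degree_eq {f : MvPolynomial (Fin (n + 1)) k} {μ : Expo n} {p : Polynomial k}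
    (hf : HatLead f μ p) (hp : p.Monic) :
    MonomialOrder.lex.degree f = embed p.natDegree μ := by
  apply MonomialOrder.lex.toSyn.injective
  apply le_antisymm
  · rw [MonomialOrder.degree_le_iff]
    exact fun m hm => lexLT_or_eq.1 (hf.of_mem_support hm)
  · apply MonomialOrder.le_degree
    rw [mem_support_iff, hf.coeff_embed, hp.coeff_natDegree]
    exact one_ne_zero

lemma HatLead.leadingCoeff_eq {f : MvPolynomial (Fin (n + 1)) k} {μ : Expo n} {p : Polynomial k}
    (hf : HatLead f μ p) (hp : p.Monic) : MonomialOrder.lex.leadingCoeff f = 1 := by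
  rw [MonomialOrder.leadingCoeff, hf.degree_eq hp, hf.coeff_embed, hp.coeff_natDegree]

lemma HatLead.leadingTerm_eq {f : MvPolynomial (Fin (n + 1)) k} {μ : Expo n} {p : Polynomial k}
    (hf : HatLead f μ p) (hp : p.Monic) :
    MonomialOrder.lex.leadingTerm f = monomial (embed p.natDegree μ) 1 := by
  rw [MonomialOrder.leadingTerm, hf.degree_eq hp, hf.leadingCoeff_eq hp]

lemma rename_castSucc_support {g : MvPolynomial (Fin n) k} {m : Expo (n + 1)}
    (hm : m ∈ (rename Fin.castSucc g).support) : ∃ e ∈ g.support, m = embed 0 e := by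
  classical
  rw [support_rename_of_injective (Fin.castSucc_injective n)] at hm
  obtain ⟨e, he, rfl⟩ := Finset.mem_image.1 hm
  exact ⟨e, he, by simp [embed]⟩

lemma degree_eq_of_leadingTerm {g : MvPolynomial (Fin n) k} {a : Expo n}
    (hg : MonomialOrder.lex.leadingTerm g = monomial a 1) : MonomialOrder.lex.degree g = a := by
  classical
  rw [← MonomialOrder.degree_leadingTerm, hg, MonomialOrder.degree_monomial, if_neg one_ne_zero]

lemma hatLead_rename_mul {g : MvPolynomial (Fin n) k} {μ : Expo n}
    (hg : MonomialOrder.lex.leadingTerm g = monomial μ 1) (c : k) (i : ℕ) :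
    HatLead (rename Fin.castSucc g * lastSub n c ^ i) μ
      ((Polynomial.X - Polynomial.C c) ^ i) := by
  have hdeg := degree_eq_of_leadingTerm hg
  have hcoeff : coeff μ g = 1 := by
    have := MonomialOrder.lex.leadingCoeff_leadingTerm g
    rwa [hg, MonomialOrder.leadingCoeff_monomial, MonomialOrder.leadingCoeff, hdeg, eq_comm] at this
  have h : HatLead (rename Fin.castSucc g) μ 1 := by
    have heq : rename Fin.castSucc g - monomial (embed 0 μ) 1 * inLast n 1 =
        rename Fin.castSucc (g - monomial μ 1) := by
      rw [inLast_one, mul_one, map_sub, rename_monomial]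
      simp [embed]
    rw [HatLead, heq, mem_hatBelow]
    intro m hm
    obtain ⟨e, he, rfl⟩ := rename_castSucc_support hm
    rw [projHat_embed]
    rw [mem_support_iff, coeff_sub, coeff_monomial] at he
    by_cases hμ : μ = e
    · subst hμ
      simp [hcoeff] at he
    · rw [if_neg hμ, sub_zero] at he
      have hle := MonomialOrder.lex.le_degree (mem_support_iff.2 he)
      rw [hdeg, ← lexLT_or_eq] at hle
      exact hle.resolve_right (Ne.symm hμ)
  have := h.mul_inLast ((Polynomial.X - Polynomial.C c) ^ i)
  rwa [one_mul, inLast_X_sub_C_pow] at this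

/-! ### Polynomial sets with prescribed leading coefficients -/

/-- `f ∈ I` has leading exponent `projHat a` and leading coefficient `P (projHat a)` with respect to
the first variables, and all its terms other than `X^a` have exponents in `D`. -/
def IsSystemElement (I : Ideal (MvPolynomial (Fin (n + 1)) k)) (D : Finset (Expo (n + 1)))
    (P : Expo n → Polynomial k) (a : Expo (n + 1)) (f : MvPolynomial (Fin (n + 1)) k) : Prop :=
  HatLead f (projHat a) (P (projHat a)) ∧ (∀ m ∈ f.support, m ≠ a → m ∈ D) ∧ f ∈ I

/-- `G` consists of polynomials `f_a`, one for each `a ∈ E(D)`, that meet these requirements. -/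
def IsLeadingSystem (I : Ideal (MvPolynomial (Fin (n + 1)) k)) (D : Finset (Expo (n + 1)))
    (P : Expo n → Polynomial k) (G : Finset (MvPolynomial (Fin (n + 1)) k)) : Prop :=
  ∃ f : Expo (n + 1) → MvPolynomial (Fin (n + 1)) k,
    (∀ a ∈ limitingSet D, IsSystemElement I D P a (f a)) ∧
    (G : Set (MvPolynomial (Fin (n + 1)) k)) = f '' limitingSet D

/-- `P` assigns to `μ` a monic polynomial whose degree is the height of the column of `D` over `μ`,
and which does not change along with `μ` as long as this height does not. -/
structure IsHeightSystem (D : Finset (Expo (n + 1))) (P : Expo n → Polynomial k) : Prop where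
  isLowerSet : IsLowerSet (D : Set (Expo (n + 1)))
  monic (μ : Expo n) : (P μ).Monic
  natDegree (μ : Expo n) : (P μ).natDegree = columnHeight D μ
  congr {μ ν : Expo n} : μ ≤ ν → columnHeight D μ = columnHeight D ν → P μ = P ν

lemma IsHeightSystem.embed_natDegree {D : Finset (Expo (n + 1))} {P : Expo n → Polynomial k}
    (hP : IsHeightSystem D P) {a : Expo (n + 1)} (ha : a ∈ limitingSet D) :
    embed (P (projHat a)).natDegree (projHat a) = a := by
  rw [hP.natDegree, ← proj_eq_of_mem_limitingSet hP.isLowerSet ha, embed_proj_projHat]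

lemma IsHeightSystem.degree_eq {D : Finset (Expo (n + 1))} {P : Expo n → Polynomial k}
    (hP : IsHeightSystem D P) {a : Expo (n + 1)} (ha : a ∈ limitingSet D)
    {f : MvPolynomial (Fin (n + 1)) k} (hf : HatLead f (projHat a) (P (projHat a))) :
    MonomialOrder.lex.degree f = a := by
  rw [hf.degree_eq (hP.monic _), hP.embed_natDegree ha]

lemma IsLeadingSystem.satisfiesAssumption {I : Ideal (MvPolynomial (Fin (n + 1)) k)}
    {D : Finset (Expo (n + 1))} {P : Expo n → Polynomial k}
    {G : Finset (MvPolynomial (Fin (n + 1)) k)} {H : PointSet k (n + 1)}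
    (hG : IsLeadingSystem I D P G) (hP : IsHeightSystem D P)
    (hI : ∀ f ∈ I, VanishesOn H f) : SatisfiesAssumption H D G := by
  obtain ⟨f, hf, hG⟩ := hG
  refine ⟨f, fun a ha => ?_, hG⟩
  obtain ⟨h₁, h₂, h₃⟩ := hf a ha
  exact ⟨by rw [h₁.leadingTerm_eq (hP.monic _), hP.embed_natDegree ha], h₂, hI _ h₃⟩

lemma glt_notMem {D : Finset (Expo (n + 1))} (hD : IsLowerSet (D : Set (Expo (n + 1))))
    (a : Expo (n + 1)) : glt a D ∉ D := by
  rw [glt_eq hD, mem_iff_lt_columnHeight hD]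
  simp

lemma IsLeadingSystem.exists_isGLP {I : Ideal (MvPolynomial (Fin (n + 1)) k)}
    {D : Finset (Expo (n + 1))} {P : Expo n → Polynomial k}
    {G : Finset (MvPolynomial (Fin (n + 1)) k)}
    (hG : IsLeadingSystem I D P G) (hP : IsHeightSystem D P) (a : Expo (n + 1)) :
    ∃ f, IsGLP a D G f := by
  obtain ⟨f, hf, hG⟩ := hG
  obtain ⟨t, ht, hta⟩ := exists_limitingSet_le (glt_notMem hP.isLowerSet a)
  refine ⟨_, t, ht, hta, f t, ?_, hP.degree_eq ht (hf t ht).1, rfl⟩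
  rw [← Finset.mem_coe, hG]
  exact ⟨t, ht, rfl⟩

/-- The shift by `X^(t - t')` involves no `Xₙ`, so it changes the leading exponent in the first
variables to `projHat a` without changing the leading coefficient. -/
lemma IsLeadingSystem.of_isGLP {I : Ideal (MvPolynomial (Fin (n + 1)) k)}
    {D : Finset (Expo (n + 1))} {P : Expo n → Polynomial k}
    {G : Finset (MvPolynomial (Fin (n + 1)) k)}
    (hG : IsLeadingSystem I D P G) (hP : IsHeightSystem D P) {a : Expo (n + 1)}
    {f : MvPolynomial (Fin (n + 1)) k} (hf : IsGLP a D G f) :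
    HatLead f (projHat a) (P (projHat a)) ∧ f ∈ I := by
  obtain ⟨F, hF, hG⟩ := hG
  obtain ⟨t, ht, hta, g, hg, hgt, rfl⟩ := hf
  rw [← Finset.mem_coe, hG] at hg
  obtain ⟨t', ht', rfl⟩ := hg
  rw [hP.degree_eq ht' (hF t' ht').1] at hgt
  subst hgt
  obtain ⟨h₁, -, h₃⟩ := hF t' ht'
  refine ⟨?_, I.mul_mem_right _ h₃⟩
  rw [glt_eq hP.isLowerSet, expo_le_iff, projHat_embed, proj_embed,
    proj_eq_of_mem_limitingSet hP.isLowerSet ht'] at hta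
  -- Divisibility bounds the height over `t'` by the height over `a`; heights being antitone, they
  -- agree, and so do the prescribed leading coefficients.
  have hheight := le_antisymm hta.2 (columnHeight_anti hP.isLowerSet hta.1)
  have hsub : glt a D - t' = embed 0 (projHat a - projHat t') := by
    rw [glt_eq hP.isLowerSet]
    refine expo_ext (by simp) ?_
    rw [proj_sub, proj_embed, proj_embed, proj_eq_of_mem_limitingSet hP.isLowerSet ht', hheight,
      Nat.sub_self]
  have := h₁.mul_monomial (projHat a - projHat t')
  rwa [add_tsub_cancel_of_le hta.1, hP.congr hta.1 hheight, ← hsub] at this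

end HatLead

/-! ### Sets of points with a common last coordinate -/

section Special

variable {k : Type*} [Field k] {n : ℕ}

/-- The ideal of the polynomials that vanish on `H`. -/
noncomputable def vanishingIdeal {n : ℕ} (H : PointSet k n) (hH : H.IsValid) :
    Ideal (MvPolynomial (Fin n) k) :=
  ⨅ x : H, vanishingIdealAt x.1.1 x.1.2 (hH.1 x x.2)

lemma mem_vanishingIdeal {H : PointSet k n} (hH : H.IsValid) {f : MvPolynomial (Fin n) k} :
    f ∈ vanishingIdeal H hH ↔ VanishesOn H f := by
  rw [vanishingIdeal, Submodule.mem_iInf, vanishesOn_iff hH]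
  exact ⟨fun h x hx => h ⟨x, hx⟩, fun h x => h x.1 x.2⟩

lemma lastSub_pow_levels_vanishesOn {H : PointSet k (n + 1)} {c : k}
    (hc : ∀ x ∈ H, x.1 (Fin.last n) = c) (f : MvPolynomial (Fin (n + 1)) k) :
    VanishesOn H (f * lastSub n c ^ levels H) := by
  intro x hx d hd
  rw [mul_comm, ← hc x hx]
  exact eval_mixedDeriv_lastSub_pow_mul _ _ (lt_levels_of_mem hx hd)

lemma isHeightSystem_pow {D : Finset (Expo (n + 1))}
    (hD : IsLowerSet (D : Set (Expo (n + 1)))) (c : k) :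
    IsHeightSystem D fun μ => (Polynomial.X - Polynomial.C c) ^ columnHeight D μ where
  isLowerSet := hD
  monic _ := (Polynomial.monic_X_sub_C c).pow _
  natDegree _ := by simp
  congr _ h := by rw [h]

lemma leadingTerm_one :
    MonomialOrder.lex.leadingTerm (1 : MvPolynomial (Fin n) k) = monomial 0 1 := by
  rw [MonomialOrder.leadingTerm, MonomialOrder.degree_one, MonomialOrder.leadingCoeff_one]

lemma degree_rename_mul {g : MvPolynomial (Fin n) k} {μ : Expo n}
    (hg : MonomialOrder.lex.leadingTerm g = monomial μ 1) (c : k) (i : ℕ) :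
    MonomialOrder.lex.degree (rename Fin.castSucc g * lastSub n c ^ i) = embed i μ := by
  rw [(hatLead_rename_mul hg c i).degree_eq ((Polynomial.monic_X_sub_C c).pow _)]
  simp

lemma IsSpecialPoly.isLeadingSystem {DD : PointSet k n → Finset (Expo n)}
    (hDD : IsMonotoneLower DD) {PP : PointSet k n → Finset (MvPolynomial (Fin n) k) → Prop}
    {H : PointSet k (n + 1)} (hH : H.IsValid) {c : k} (hc : ∀ x ∈ H, x.1 (Fin.last n) = c)
    (hPP : ∀ i < levels H, ∀ G, PP (slice H i) G →
      SatisfiesAssumption (slice H i) (DD (slice H i)) G)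
    {G : Finset (MvPolynomial (Fin (n + 1)) k)} (hG : IsSpecialPoly DD PP H c G) :
    IsLeadingSystem (vanishingIdeal H hH) (specialLowerSet DD H)
      (fun μ => (Polynomial.X - Polynomial.C c) ^ columnHeight (specialLowerSet DD H) μ) G := by
  classical
  have hD := hDD.isLowerSet_special hH hc
  obtain ⟨Gt, hGt, rfl⟩ := hG
  have hF := fun i hi => hPP i hi (Gt i) (hGt i hi)
  unfold SatisfiesAssumption at hF
  choose! F hF hGF using hF
  -- The value `1` accounts for the extra polynomial `(Xₙ - c)^(w+1)`, so that all elements have the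
  -- same shape.
  let F' : Expo (n + 1) → MvPolynomial (Fin n) k := fun a =>
    if proj a < levels H then F (proj a) (projHat a) else 1
  have hlead : ∀ a ∈ limitingSet (specialLowerSet DD H),
      MonomialOrder.lex.leadingTerm (F' a) = monomial (projHat a) 1 := by
    intro a ha
    by_cases hlt : proj a < levels H
    · simp only [F', if_pos hlt]
      exact (hF _ hlt _ (projHat_mem_limitingSet ha hlt)).1
    · simp only [F', if_neg hlt]
      rw [leadingTerm_one, projHat_eq_zero_of_levels_le ha (not_lt.1 hlt)]
  have hsupp : ∀ a ∈ limitingSet (specialLowerSet DD H), ∀ e ∈ (F' a).support,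
      e ≠ projHat a → embed (proj a) e ∈ specialLowerSet DD H := by
    intro a ha e he hne
    by_cases hlt : proj a < levels H
    · simp only [F', if_pos hlt] at he
      rw [mem_specialLowerSet, proj_embed, projHat_embed]
      exact ⟨hlt, (hF _ hlt _ (projHat_mem_limitingSet ha hlt)).2.1 e he hne⟩
    · simp only [F', if_neg hlt] at he
      rw [projHat_eq_zero_of_levels_le ha (not_lt.1 hlt)] at hne
      rw [← C_1, ← monomial_zero'] at he
      exact absurd (Finset.mem_singleton.1 (support_monomial_subset he)) hne
  have hvan : ∀ a ∈ limitingSet (specialLowerSet DD H), ∀ x ∈ H, ∀ d ∈ x.2, proj d = proj a →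
      eval (fun j => x.1 j.castSucc) (mixedDeriv (projHat d) (F' a)) = 0 := by
    intro a ha x hx d hd hda
    have hlt : proj a < levels H := hda ▸ lt_levels_of_mem hx hd
    simp only [F', if_pos hlt]
    have hd' : embed (proj a) (projHat d) ∈ x.2 := by rwa [← hda, embed_proj_projHat]
    obtain ⟨y, hy, hyx, hyd⟩ := exists_mem_slice hx hd'
    have := (hF _ hlt _ (projHat_mem_limitingSet ha hlt)).2.2 y hy (projHat d) ((hyd _).2 hd')
    rwa [hyx] at this
  refine ⟨fun a => rename Fin.castSucc (F' a) * lastSub n c ^ proj a, fun a ha => ⟨?_, ?_, ?_⟩, ?_⟩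
  · have := hatLead_rename_mul (hlead a ha) c (proj a)
    beta_reduce
    rwa [← proj_eq_of_mem_limitingSet hD ha]
  · intro m hm hma
    beta_reduce at hm
    rw [← inLast_X_sub_C_pow] at hm
    obtain ⟨e, he, hme, hle⟩ := exists_of_mem_support_mul_inLast hm
    obtain ⟨e', he', rfl⟩ := rename_castSucc_support he
    rw [projHat_embed] at hme
    rw [proj_embed, zero_add, Polynomial.natDegree_pow, Polynomial.natDegree_X_sub_C,
      mul_one] at hle
    subst hme
    -- In the column of `a`, everything strictly below `a` is in `D`. In another column, the slice
    -- at level `proj a` provides an element of `D` above `m`.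
    by_cases hh : projHat m = projHat a
    · rw [mem_iff_lt_columnHeight hD, hh, ← proj_eq_of_mem_limitingSet hD ha]
      exact lt_of_le_of_ne hle fun h => hma (expo_ext hh h)
    · exact hD (expo_le_iff.2 ⟨by simp, by simpa using hle⟩) (hsupp a ha _ he' hh)
  · rw [mem_vanishingIdeal]
    intro x hx d hd
    have := eval_mixedDeriv_rename_mul x.1 (F' a) d (proj a) (hvan a ha x hx d hd)
    rwa [hc x hx] at this
  · ext g
    simp only [Finset.coe_filter, Finset.mem_union, Finset.mem_biUnion, Finset.mem_range,
      Finset.mem_image, Finset.mem_singleton, Set.mem_ofPred_eq, Set.mem_image]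
    constructor
    · rintro ⟨⟨i, hi, g, hg, rfl⟩ | rfl, hdeg⟩
      · rw [← Finset.mem_coe, hGF i hi] at hg
        obtain ⟨b, hb, rfl⟩ := hg
        rw [degree_rename_mul (hF i hi b hb).1] at hdeg
        refine ⟨_, hdeg, ?_⟩
        simp only [F', proj_embed, projHat_embed, if_pos hi]
      · have h := degree_rename_mul (leadingTerm_one (k := k) (n := n)) c (levels H)
        rw [map_one, one_mul] at h
        rw [h] at hdeg
        refine ⟨_, hdeg, ?_⟩
        simp only [F', proj_embed, lt_irrefl, if_false, map_one, one_mul]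
    · rintro ⟨a, ha, rfl⟩
      rw [degree_rename_mul (hlead a ha), embed_proj_projHat]
      refine ⟨?_, ha⟩
      by_cases hlt : proj a < levels H
      · refine Or.inl ⟨proj a, hlt, F' a, ?_, rfl⟩
        rw [← Finset.mem_coe, hGF _ hlt]
        exact ⟨projHat a, projHat_mem_limitingSet ha hlt, by simp only [F', if_pos hlt]⟩
      · right
        have hle : proj a ≤ levels H := by
          rw [proj_eq_of_mem_limitingSet hD ha]
          -- No column exceeds `levels H`, so an element of `E(D)` on no slice has last entry
          -- exactly `levels H`.
          exact columnHeight_special_le_levels hD _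
        simp only [F', if_neg hlt, map_one, one_mul]
        rw [le_antisymm hle (not_lt.1 hlt)]

lemma exists_isSpecialPoly (DD : PointSet k n → Finset (Expo n))
    {PP : PointSet k n → Finset (MvPolynomial (Fin n) k) → Prop} {H : PointSet k (n + 1)} (c : k)
    (hPP : ∀ i < levels H, ∃ G, PP (slice H i) G) : ∃ G, IsSpecialPoly DD PP H c G := by
  choose! Gt hGt using hPP
  exact ⟨_, Gt, hGt, rfl⟩

end Special

/-! ### The loops of the algorithm -/

section Loops

variable {k : Type*} [Field k] {n : ℕ}

/-! ### Inner loop: reduction and termination -/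

/-- The invariant of the inner loop. -/
def IsPartialSystem (I : Ideal (MvPolynomial (Fin (n + 1)) k)) (D : Finset (Expo (n + 1)))
    (P : Expo n → Polynomial k) (MS : Set (Expo (n + 1)))
    (G : Finset (MvPolynomial (Fin (n + 1)) k)) : Prop :=
  MS ⊆ limitingSet D ∧ (∀ a ∈ limitingSet D \ MS, ∀ b ∈ MS, lexLT a b) ∧
    ∃ f : Expo (n + 1) → MvPolynomial (Fin (n + 1)) k,
      (∀ a ∈ limitingSet D \ MS, IsSystemElement I D P a (f a)) ∧
      (G : Set (MvPolynomial (Fin (n + 1)) k)) = f '' (limitingSet D \ MS)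

variable {I : Ideal (MvPolynomial (Fin (n + 1)) k)} {D : Finset (Expo (n + 1))}
  {P : Expo n → Polynomial k} {MS : Set (Expo (n + 1))}
  {G : Finset (MvPolynomial (Fin (n + 1)) k)}

lemma IsPartialSystem.isSystemElement (hP : IsHeightSystem D P) (hG : IsPartialSystem I D P MS G)
    {a : Expo (n + 1)} (ha : a ∈ MS)
    (hmin : ∀ b ∈ MS, MonomialOrder.lex.toSyn a ≤ MonomialOrder.lex.toSyn b)
    {f f' : MvPolynomial (Fin (n + 1)) k} (hf : HatLead f (projHat a) (P (projHat a)))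
    (hfI : f ∈ I) (hred : IsReduction G f f') : IsSystemElement I D P a f' := by
  obtain ⟨hMS, hlt, F, hF, hGF⟩ := hG
  obtain ⟨h, hsum, hdeg, hrem⟩ := hred
  have haE := hMS ha
  have hG : ∀ g ∈ G, ∃ b ∈ limitingSet D \ MS, F b = g := fun g hg => by
    rw [← Finset.mem_coe, hGF] at hg
    exact hg
  have hI : ∑ g ∈ G, g * h g ∈ I := by
    refine Ideal.sum_mem _ fun g hg => I.mul_mem_right _ ?_
    obtain ⟨b, hb, rfl⟩ := hG g hg
    exact (hF b hb).2.2
  have hbelow : ∑ g ∈ G, g * h g ∈ hatBelow k (projHat a) := by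
    refine Submodule.sum_mem _ fun g hg => ?_
    obtain ⟨b, hb, rfl⟩ := hG g hg
    -- The degree is additive only for nonzero factors.
    by_cases hzero : F b * h (F b) = 0
    · rw [hzero]
      exact Submodule.zero_mem _
    have hle := hdeg _ hg
    rw [hP.degree_eq haE hf, ← lexLT_or_eq, lexLT_succ_iff] at hle
    have hb_le : b ≤ MonomialOrder.lex.degree (F b * h (F b)) := by
      rw [MonomialOrder.degree_mul (left_ne_zero_of_mul hzero) (right_ne_zero_of_mul hzero),
        hP.degree_eq hb.1 (hF b hb).1]
      exact le_self_add
    -- The leading exponent of the product is a multiple of `b ∉ D`. Lower down in the column of `a`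
    -- it would lie in `D`; equal to `a` it would force `b = a` by minimality, but `a` is still
    -- untreated.
    have hlt' : lexLT (projHat (MonomialOrder.lex.degree (F b * h (F b)))) (projHat a) := by
      rcases hle with (hle | ⟨hhat, hle⟩) | heq
      · exact hle
      · exfalso
        refine hb.1.1 (hP.isLowerSet hb_le ?_)
        rw [Finset.mem_coe, mem_iff_lt_columnHeight hP.isLowerSet, hhat,
          ← proj_eq_of_mem_limitingSet hP.isLowerSet haE]
        exact hle
      · rw [heq] at hb_le
        have := eq_of_le_of_mem_limitingSet hP.isLowerSet haE hb.1.1 hb_le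
        exact absurd (this ▸ ha) hb.2
    rw [mem_hatBelow]
    intro m hm
    have hm := MonomialOrder.lex.le_degree hm
    rw [← lexLT_or_eq, lexLT_succ_iff] at hm
    rcases hm with (hm | ⟨hm, -⟩) | rfl
    · exact hm.trans hlt'
    · rwa [hm]
    · exact hlt'
  have hf' : f' = f - ∑ g ∈ G, g * h g := by rw [hsum, add_sub_cancel_left]
  have hlead : HatLead f' (projHat a) (P (projHat a)) := hf' ▸ hf.sub_mem hbelow
  refine ⟨hlead, fun m hm hma => ?_, hf' ▸ I.sub_mem hfI hI⟩
  by_contra hmD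
  have hmlt := hlead.of_mem_support hm
  rw [hP.embed_natDegree haE] at hmlt
  -- A bad term is divisible by some `X^e`, `e ∈ E(D)`, with `e` lexicographically below `a`. As `a`
  -- is the least untreated exponent, `e` has been treated, and its polynomial would divide the term
  -- by its leading monomial.
  obtain ⟨e, he, hem⟩ := exists_limitingSet_le hmD
  have hea : lexLT e a := by
    have hma := hmlt.resolve_right hma
    by_cases h : e = m
    · rwa [h]
    · exact (lexLT_of_le_of_ne hem h).trans hma
  have heMS : e ∈ limitingSet D \ MS := ⟨he, fun h => (hmin e h).not_gt hea⟩
  refine hrem m hm (F e) ?_ ?_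
  · rw [← Finset.mem_coe, hGF]
    exact ⟨e, heMS, rfl⟩
  · rwa [hP.degree_eq he (hF e heMS).1]

lemma InnerLoop.isPartialSystem (hP : IsHeightSystem D P)
    {comb : Expo (n + 1) → MvPolynomial (Fin (n + 1)) k → Prop}
    (hcomb : ∀ a f, comb a f → HatLead f (projHat a) (P (projHat a)) ∧ f ∈ I)
    (hloop : InnerLoop (limitingSet D) comb MS G) : IsPartialSystem I D P MS G := by
  classical
  induction hloop with
  | start => exact ⟨subset_rfl, by simp, fun _ => 0, by simp, by simp⟩
  | step MS Gh Gh' a f f' _ ha hmin hc hred hGh' ih =>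
    have hel := ih.isSystemElement hP ha hmin (hcomb a f hc).1 (hcomb a f hc).2 hred
    obtain ⟨hMS, hlt, F, hF, hGF⟩ := ih
    have hdiff : limitingSet D \ (MS \ {a}) = insert a (limitingSet D \ MS) := by
      ext b
      simp only [Set.mem_sdiff, Set.mem_singleton_iff, Set.mem_insert_iff]
      have := hMS ha
      by_cases hba : b = a
      · simp [hba, this]
      · simp [hba]
    have ha' : a ∉ limitingSet D \ MS := fun h => h.2 ha
    have hF' : ∀ b ∈ limitingSet D \ MS, Function.update F a f' b = F b := fun b hb =>
      Function.update_of_ne (ne_of_mem_of_not_mem hb ha') _ _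
    refine ⟨Set.sdiff_subset.trans hMS, ?_, Function.update F a f', ?_, ?_⟩
    · rw [hdiff]
      rintro b (rfl | hb) e he
      · exact lt_of_le_of_ne (hmin e he.1) fun h =>
          he.2 (MonomialOrder.lex.toSyn.injective h).symm
      · exact hlt b hb e he.1
    · rw [hdiff]
      rintro b (rfl | hb)
      · rwa [Function.update_self]
      · rw [hF' b hb]
        exact hF b hb
    · rw [hdiff, Set.image_insert_eq, Function.update_self, Set.image_congr hF', ← hGF]
      ext g
      rw [Finset.mem_coe, hGh', Set.mem_insert_iff, Finset.mem_coe, or_comm]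

/-- Division is possible because leading coefficients `1` are units. -/
lemma exists_isReduction {σ : ℕ} {G : Finset (MvPolynomial (Fin σ) k)}
    (hG : ∀ g ∈ G, MonomialOrder.lex.leadingCoeff g = 1) (f : MvPolynomial (Fin σ) k) :
    ∃ f', IsReduction G f f' := by
  classical
  obtain ⟨q, r, h₁, h₂, h₃⟩ := MonomialOrder.lex.div (b := fun g : G => g.1)
    (fun g => by rw [hG g.1 g.2]; exact isUnit_one) f
  refine ⟨r, fun g => if hg : g ∈ G then q ⟨g, hg⟩ else 0, ?_, fun g hg => ?_,
    fun m hm g hg => h₃ m hm ⟨g, hg⟩⟩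
  · rw [Finsupp.linearCombination_apply, Finsupp.sum_fintype _ _ (by simp)] at h₁
    rw [← Finset.sum_coe_sort, h₁]
    refine congrArg (· + r) (Finset.sum_congr rfl fun g _ => ?_)
    beta_reduce
    rw [dif_pos g.2, smul_eq_mul, mul_comm]
  · beta_reduce
    rw [dif_pos hg]
    exact h₂ ⟨g, hg⟩

lemma InnerLoop.exists_finish (hP : IsHeightSystem D P)
    {comb : Expo (n + 1) → MvPolynomial (Fin (n + 1)) k → Prop}
    (hcomb : ∀ a f, comb a f → HatLead f (projHat a) (P (projHat a)) ∧ f ∈ I)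
    (hex : ∀ a, ∃ f, comb a f) : ∃ G, InnerLoop (limitingSet D) comb ∅ G := by
  classical
  -- Induction on the number of untreated exponents, starting from any reachable state.
  suffices h : ∀ N : ℕ, ∀ MS G, InnerLoop (limitingSet D) comb MS G → MS.ncard = N →
      ∃ G, InnerLoop (limitingSet D) comb ∅ G from h _ _ _ .start rfl
  intro N
  induction N with
  | zero =>
    intro MS G hloop hcard
    have hfin := (limitingSet_finite D).subset (hloop.isPartialSystem hP hcomb).1
    rw [Set.ncard_eq_zero hfin] at hcard
    exact ⟨G, hcard ▸ hloop⟩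
  | succ N ih =>
    intro MS G hloop hcard
    obtain ⟨hMS, -, F, hF, hGF⟩ := hloop.isPartialSystem hP hcomb
    have hfin := (limitingSet_finite D).subset hMS
    have hne : MS.Nonempty := Set.nonempty_of_ncard_ne_zero (by omega)
    obtain ⟨a, ha, hmin⟩ := Set.exists_min_image MS MonomialOrder.lex.toSyn hfin hne
    obtain ⟨f, hf⟩ := hex a
    obtain ⟨f', hf'⟩ := exists_isReduction (G := G) (fun g hg => by
      rw [← Finset.mem_coe, hGF] at hg
      obtain ⟨b, hb, rfl⟩ := hg
      exact (hF b hb).1.leadingCoeff_eq (hP.monic _)) f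
    refine ih (MS \ {a}) (insert f' G) (.step MS G _ a f f' hloop ha hmin hf hf' ?_) ?_
    · intro g
      rw [Finset.mem_insert, or_comm]
    · rw [Set.ncard_sdiff_singleton_of_mem ha, hcard, Nat.add_sub_cancel]

lemma InnerLoop.isLeadingSystem (hP : IsHeightSystem D P)
    {comb : Expo (n + 1) → MvPolynomial (Fin (n + 1)) k → Prop}
    (hcomb : ∀ a f, comb a f → HatLead f (projHat a) (P (projHat a)) ∧ f ∈ I)
    (hloop : InnerLoop (limitingSet D) comb ∅ G) : IsLeadingSystem I D P G := by
  obtain ⟨-, -, f, hf, hG⟩ := hloop.isPartialSystem hP hcomb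
  rw [Set.sdiff_empty] at hf hG
  exact ⟨f, hf, hG⟩

/-! ### Outer loop: adding a fibre -/

/-- The data of the fibres: lower sets `D'`, numbers `L`, ideals `I` and possible polynomial
sets. -/
structure IsFibreData (C : Finset k) (D' : k → Finset (Expo (n + 1))) (L : k → ℕ)
    (PF : k → Finset (MvPolynomial (Fin (n + 1)) k) → Prop)
    (I : k → Ideal (MvPolynomial (Fin (n + 1)) k)) : Prop where
  isLowerSet (c : k) : IsLowerSet (D' c : Set (Expo (n + 1)))
  columnHeight_le (c : k) (μ : Expo n) : columnHeight (D' c) μ ≤ L c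
  mul_lastSub_pow_mem (c : k) (f : MvPolynomial (Fin (n + 1)) k) : f * lastSub n c ^ L c ∈ I c
  isLeadingSystem {c : k} (hc : c ∈ C) {G : Finset (MvPolynomial (Fin (n + 1)) k)} :
    PF c G → IsLeadingSystem (I c) (D' c)
      (fun μ => (Polynomial.X - Polynomial.C c) ^ columnHeight (D' c) μ) G
  exists_poly {c : k} (hc : c ∈ C) : ∃ G, PF c G

/-- The leading coefficients of the polynomials for the fibres over `S`. -/
noncomputable def fibreProd (D' : k → Finset (Expo (n + 1))) (S : Finset k) (μ : Expo n) :
    Polynomial k :=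
  ∏ b ∈ S, (Polynomial.X - Polynomial.C b) ^ columnHeight (D' b) μ

variable {C : Finset k} {D' : k → Finset (Expo (n + 1))} {L : k → ℕ}
  {PF : k → Finset (MvPolynomial (Fin (n + 1)) k) → Prop}
  {J : k → Ideal (MvPolynomial (Fin (n + 1)) k)} {S : Finset k}
  {Gc : Finset (MvPolynomial (Fin (n + 1)) k)} {c : k}

lemma isHeightSystem_fibreProd (hD' : ∀ c, IsLowerSet (D' c : Set (Expo (n + 1))))
    (hD : IsLowerSet (D : Set (Expo (n + 1))))
    (hsum : ∀ μ, columnHeight D μ = ∑ b ∈ S, columnHeight (D' b) μ) :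
    IsHeightSystem D (fibreProd D' S) where
  isLowerSet := hD
  monic _ := Polynomial.monic_prod_of_monic _ _ fun b _ => (Polynomial.monic_X_sub_C b).pow _
  natDegree μ := by
    rw [fibreProd, Polynomial.natDegree_prod_of_monic _ _
      fun b _ => (Polynomial.monic_X_sub_C b).pow _, hsum]
    simp
  -- Each fibre's height is antitone, so equal sums force equal heights fibre by fibre. This is why
  -- equality is demanded only for comparable `μ ≤ ν`.
  congr {μ ν} hle h := by
    rw [hsum, hsum, eq_comm,
      Finset.sum_eq_sum_iff_of_le fun b _ => columnHeight_anti (hD' b) hle] at h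
    exact Finset.prod_congr rfl fun b hb => by rw [h b hb]

/-- Each full power splits into the part counted by the height and a rest. The first parts form the
desired leading coefficient in both summands, and the Bézout relation between the rests makes the
cofactors sum to one. -/
lemma IsCombination.hatLead_and_mem (hJ : IsFibreData C D' L PF J)
    (hP : IsHeightSystem D (fibreProd D' S))
    (hG : IsLeadingSystem (S.inf J) D (fibreProd D' S) G)
    (hGc : IsLeadingSystem (J c) (D' c)
      (fun μ => (Polynomial.X - Polynomial.C c) ^ columnHeight (D' c) μ) Gc) (hc : c ∉ S)
    {a : Expo (n + 1)} {f : MvPolynomial (Fin (n + 1)) k}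
    (hf : IsCombination D' L S D G c Gc a f) :
    HatLead f (projHat a) (fibreProd D' (S.cons c hc) (projHat a)) ∧ f ∈ (S.cons c hc).inf J := by
  obtain ⟨f₁, f₂, r₁, r₂, h₁, h₂, hr, rfl⟩ := hf
  obtain ⟨hl₁, hI₁⟩ := hG.of_isGLP hP h₁
  obtain ⟨hl₂, hI₂⟩ := hGc.of_isGLP (isHeightSystem_pow (hJ.isLowerSet c) c) h₂
  have hglt : ∀ b, proj (glt a (D' b)) = columnHeight (D' b) (projHat a) := fun b => by
    rw [glt_eq (hJ.isLowerSet b), proj_embed]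
  simp only [hglt] at hr
  constructor
  · have h₁' := (hl₁.mul_inLast ((Polynomial.X - Polynomial.C c) ^ L c)).mul_inLast r₁
    have h₂' := (hl₂.mul_inLast (∏ b ∈ S, (Polynomial.X - Polynomial.C b) ^ L b)).mul_inLast r₂
    have h := h₁'.add h₂'
    simp only [inLast_prod, inLast_X_sub_C_pow] at h
    rw [mul_comm (inLast n r₁), mul_comm (inLast n r₂)]
    convert h using 1
    have hpow : ∀ b : k, (Polynomial.X - Polynomial.C b) ^ L b =
        (Polynomial.X - Polynomial.C b) ^ columnHeight (D' b) (projHat a) *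
          (Polynomial.X - Polynomial.C b) ^ (L b - columnHeight (D' b) (projHat a)) := fun b => by
      rw [← pow_add, Nat.add_sub_cancel' (hJ.columnHeight_le b _)]
    have hprod : ∏ b ∈ S, (Polynomial.X - Polynomial.C b) ^ L b = fibreProd D' S (projHat a) *
        ∏ b ∈ S, (Polynomial.X - Polynomial.C b) ^ (L b - columnHeight (D' b) (projHat a)) := by
      rw [fibreProd, ← Finset.prod_mul_distrib]
      exact Finset.prod_congr rfl fun b _ => hpow b
    have hcons : fibreProd D' (S.cons c hc) (projHat a) =
        (Polynomial.X - Polynomial.C c) ^ columnHeight (D' c) (projHat a) *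
          fibreProd D' S (projHat a) := by
      rw [fibreProd, Finset.prod_cons, fibreProd]
    rw [hprod, hpow c, hcons]
    linear_combination (-((Polynomial.X - Polynomial.C c) ^ columnHeight (D' c) (projHat a) *
      fibreProd D' S (projHat a))) * hr
  · rw [Finset.inf_cons, Submodule.mem_inf]
    constructor
    -- On the new fibre the first summand vanishes by its power of `Xₙ - c`, the second by `f₂`; on
    -- the old fibres the roles are exchanged.
    · refine add_mem (Ideal.mul_mem_left _ _ (hJ.mul_lastSub_pow_mem c f₁)) ?_
      exact Ideal.mul_mem_left _ _ (Ideal.mul_mem_right _ _ hI₂)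
    · refine add_mem (Ideal.mul_mem_left _ _ (Ideal.mul_mem_right _ _ hI₁)) ?_
      refine Ideal.mul_mem_left _ _ (Submodule.mem_finsetInf.2 fun b hb => ?_)
      classical
      rw [← Finset.prod_erase_mul _ _ hb, ← mul_assoc]
      exact hJ.mul_lastSub_pow_mem b _

/-- Powers of `Xₙ - c` and `Xₙ - b` are coprime for `b ≠ c`, which provides the cofactors. -/
lemma exists_isCombination (hJ : IsFibreData C D' L PF J)
    (hP : IsHeightSystem D (fibreProd D' S))
    (hG : IsLeadingSystem (S.inf J) D (fibreProd D' S) G)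
    (hGc : IsLeadingSystem (J c) (D' c)
      (fun μ => (Polynomial.X - Polynomial.C c) ^ columnHeight (D' c) μ) Gc) (hc : c ∉ S)
    (a : Expo (n + 1)) : ∃ f, IsCombination D' L S D G c Gc a f := by
  obtain ⟨f₁, hf₁⟩ := hG.exists_isGLP hP a
  obtain ⟨f₂, hf₂⟩ := hGc.exists_isGLP (isHeightSystem_pow (hJ.isLowerSet c) c) a
  have hcop : IsCoprime ((Polynomial.X - Polynomial.C c) ^ (L c - proj (glt a (D' c))))
      (∏ b ∈ S, (Polynomial.X - Polynomial.C b) ^ (L b - proj (glt a (D' b)))) := by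
    refine IsCoprime.prod_right fun b hb => IsCoprime.pow ?_
    exact Polynomial.isCoprime_X_sub_C_of_isUnit_sub
      (isUnit_iff_ne_zero.2 (sub_ne_zero.2 fun h => hc (h ▸ hb)))
  obtain ⟨r₁, r₂, hr⟩ := hcop
  exact ⟨_, f₁, f₂, r₁, r₂, hf₁, hf₂, hr, rfl⟩

lemma columnHeight_addLower_eq_sum (hJ : IsFibreData C D' L PF J)
    (hD : IsLowerSet (D : Set (Expo (n + 1))))
    (hsum : ∀ μ, columnHeight D μ = ∑ b ∈ S, columnHeight (D' b) μ) (hc : c ∉ S) (μ : Expo n) :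
    columnHeight (addLower D (D' c)) μ = ∑ b ∈ S.cons c hc, columnHeight (D' b) μ := by
  rw [columnHeight_addLower hD (hJ.isLowerSet c), hsum, Finset.sum_cons, add_comm]

/-- The system for the treated fibres is kept together with its prescribed leading coefficients,
since leading exponents alone would not suffice to combine it with the next fibre. -/
lemma OuterLoop.invariant (hJ : IsFibreData C D' L PF J) (hloop : OuterLoop C D' L PF S D G) :
    IsLowerSet (D : Set (Expo (n + 1))) ∧
      (∀ μ, columnHeight D μ = ∑ b ∈ S, columnHeight (D' b) μ) ∧
      IsLeadingSystem (S.inf J) D (fibreProd D' S) G := by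
  induction hloop with
  | start c Gc hc hPF =>
    refine ⟨hJ.isLowerSet c, fun μ => by simp, ?_⟩
    rw [Finset.inf_singleton]
    convert hJ.isLeadingSystem hc hPF using 2
    rw [fibreProd, Finset.prod_singleton]
  | step S D G Gc Gh c hcS _ hc hPF hinner ih =>
    obtain ⟨hD, hsum, hG⟩ := ih
    have hD₂ := isLowerSet_addLower hD (hJ.isLowerSet c)
    have hsum₂ := columnHeight_addLower_eq_sum hJ hD hsum hcS
    refine ⟨hD₂, hsum₂, ?_⟩
    exact hinner.isLeadingSystem (isHeightSystem_fibreProd hJ.isLowerSet hD₂ hsum₂)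
      fun a f hf => hf.hatLead_and_mem hJ (isHeightSystem_fibreProd hJ.isLowerSet hD hsum) hG
        (hJ.isLeadingSystem hc hPF) hcS

lemma exists_outerLoop (hJ : IsFibreData C D' L PF J) (hS : S.Nonempty) (hSC : S ⊆ C) :
    ∃ D G, OuterLoop C D' L PF S D G := by
  induction hS using Finset.Nonempty.cons_induction with
  | singleton c =>
    have hc : c ∈ C := hSC (Finset.mem_singleton_self c)
    obtain ⟨G, hG⟩ := hJ.exists_poly hc
    exact ⟨_, G, .start c G hc hG⟩
  | cons c S hcS _ ih =>
    rw [Finset.cons_subset] at hSC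
    obtain ⟨D, G, hloop⟩ := ih hSC.2
    obtain ⟨Gc, hGc⟩ := hJ.exists_poly hSC.1
    obtain ⟨hD, hsum, hG⟩ := hloop.invariant hJ
    have hP := isHeightSystem_fibreProd hJ.isLowerSet hD hsum
    have hsys := hJ.isLeadingSystem hSC.1 hGc
    obtain ⟨Gh, hinner⟩ := InnerLoop.exists_finish
      (isHeightSystem_fibreProd hJ.isLowerSet (isLowerSet_addLower hD (hJ.isLowerSet c))
        (columnHeight_addLower_eq_sum hJ hD hsum hcS))
      (fun a f hf => IsCombination.hatLead_and_mem hJ hP hG hsys hcS hf)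
      (exists_isCombination hJ hP hG hsys hcS)
    exact ⟨_, Gh, .step S D G Gc Gh c hcS hloop hSC.1 hGc hinner⟩

end Loops

/-! ### Dimension one -/

section DimensionOne

variable {k : Type*} [Field k]

/-- In dimension one a lower set is an initial segment and consists of a single column. -/
lemma lt_card_of_mem {D : Finset (Expo 1)} (hD : IsLowerSet (D : Set (Expo 1))) {d : Expo 1}
    (hd : d ∈ D) : proj d < D.card :=
  ((mem_iff_lt_columnHeight hD).1 hd).trans_le (Finset.card_filter_le _ _)

lemma columnHeight_lowerSetOf_zero {k : Type*} (H : PointSet k 1) (μ : Expo 0) :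
    columnHeight (lowerSetOf 0 H) μ = ∑ x ∈ H, x.2.card :=
  columnHeight_eq (h := fun _ => ∑ x ∈ H, x.2.card) (fun _ => mem_lowerSetOf_zero) μ

lemma satisfiesAssumption_zero {H : PointSet k 1} (hH : H.IsValid) :
    SatisfiesAssumption H (lowerSetOf 0 H)
      {∏ x ∈ H, (X 0 - C (x.1 0)) ^ x.2.card} := by
  classical
  have hD := isLowerSet_lowerSetOf hH
  let p : Polynomial k := ∏ x ∈ H, (Polynomial.X - Polynomial.C (x.1 0)) ^ x.2.card
  have hp : inLast 0 p = ∏ x ∈ H, (X 0 - C (x.1 0)) ^ x.2.card := by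
    simp only [p, inLast_prod, inLast_X_sub_C_pow]
    rfl
  have hmonic : p.Monic :=
    Polynomial.monic_prod_of_monic _ _ fun x _ => (Polynomial.monic_X_sub_C _).pow _
  have hdeg : p.natDegree = ∑ x ∈ H, x.2.card := by
    rw [Polynomial.natDegree_prod_of_monic _ _ fun x _ => (Polynomial.monic_X_sub_C _).pow _]
    simp
  -- With no first variables the polynomial is its own leading coefficient, and `E(D)` has a single
  -- element.
  have hlead : HatLead (inLast 0 p) 0 p := by
    have : embed 0 (0 : Expo 0) = 0 := by simp [embed]
    rw [HatLead, this, monomial_zero', C_1, one_mul, sub_self]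
    exact Submodule.zero_mem _
  have hE : ∀ a ∈ limitingSet (lowerSetOf 0 H), a = embed p.natDegree 0 := fun a ha =>
    expo_ext (Subsingleton.elim _ _) (by
      rw [proj_embed, proj_eq_of_mem_limitingSet hD ha, columnHeight_lowerSetOf_zero, hdeg])
  rw [← hp]
  refine ⟨fun _ => inLast 0 p, fun a ha => ⟨?_, fun m hm hma => ?_, fun x hx d hd => ?_⟩, ?_⟩
  · rw [hE a ha, hlead.leadingTerm_eq hmonic]
  · have := hlead.of_mem_support hm
    rw [← hE a ha] at this
    rcases lexLT_succ_iff.1 (this.resolve_right hma) with ⟨i, -⟩ | ⟨-, h⟩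
    · exact i.elim0
    · rw [mem_lowerSetOf_zero, ← hdeg]
      rwa [hE a ha, proj_embed] at h
  · rw [hp, ← Finset.mul_prod_erase _ _ hx]
    exact eval_mixedDeriv_lastSub_pow_mul x.1 _ (lt_card_of_mem (hH.1 x hx) hd)
  · obtain ⟨a, ha, -⟩ := exists_limitingSet_le (glt_notMem hD 0)
    rw [Set.Nonempty.image_const ⟨a, ha⟩, Finset.coe_singleton]

end DimensionOne

/-! ### Induction over the dimension -/

section Main

variable {k : Type*} [Field k]

/-- The vanishing ideal of the fibre over `c`. -/
noncomputable abbrev fibreIdeal {n : ℕ} {H : PointSet k (n + 1)} (hH : H.IsValid) (c : k) :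
    Ideal (MvPolynomial (Fin (n + 1)) k) :=
  vanishingIdeal (fibre H c) (hH.fibre c)

/-- The induction hypothesis enters only here, through the slices of the fibres. -/
lemma isFibreData {n : ℕ}
    (ih : ∀ H : PointSet k (n + 1), H.IsValid → H.Nonempty →
      (∃ G, IsPoly n H G) ∧ ∀ G, IsPoly n H G → SatisfiesAssumption H (lowerSetOf n H) G)
    {H : PointSet k (n + 2)} (hH : H.IsValid) :
    IsFibreData (lastCoords H) (fun c => specialLowerSet (lowerSetOf n) (fibre H c))
      (fun c => levels (fibre H c))
      (fun c Gc => IsSpecialPoly (lowerSetOf n) (IsPoly n) (fibre H c) c Gc)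
      (fibreIdeal hH) where
  isLowerSet c := (isMonotoneLower_lowerSetOf n).isLowerSet_special_fibre hH c
  columnHeight_le c := columnHeight_special_le_levels
    ((isMonotoneLower_lowerSetOf n).isLowerSet_special_fibre hH c)
  mul_lastSub_pow_mem c f :=
    (mem_vanishingIdeal _).2 (lastSub_pow_levels_vanishesOn (fibre_last H c) f)
  isLeadingSystem {c} _ _ hG :=
    hG.isLeadingSystem (isMonotoneLower_lowerSetOf n) (hH.fibre c) (fibre_last H c)
      fun i hi => (ih _ ((hH.fibre c).slice (fibre_last H c) i)
        (slice_nonempty (hH.fibre c) hi)).2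
  exists_poly {c} _ := exists_isSpecialPoly _ c fun i hi =>
    (ih _ ((hH.fibre c).slice (fibre_last H c) i) (slice_nonempty (hH.fibre c) hi)).1

lemma vanishesOn_of_mem_inf_fibreIdeal {n : ℕ} {H : PointSet k (n + 1)} (hH : H.IsValid)
    {f : MvPolynomial (Fin (n + 1)) k} (hf : f ∈ (lastCoords H).inf (fibreIdeal hH)) :
    VanishesOn H f := by
  intro x hx
  have := Submodule.mem_finsetInf.1 hf _ (mem_lastCoords.2 ⟨x, hx, rfl⟩)
  exact (mem_vanishingIdeal _).1 this x (mem_fibre.2 ⟨hx, rfl⟩)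

end Main

end PointIdeal

theorem theorem3 {k : Type*} [Field k] (n : ℕ) (H : PointIdeal.PointSet k (n + 1))
    (hH : H.IsValid) (hne : H.Nonempty) :
    (∃ G : Finset (MvPolynomial (Fin (n + 1)) k), PointIdeal.IsPoly n H G) ∧
    ∀ G : Finset (MvPolynomial (Fin (n + 1)) k), PointIdeal.IsPoly n H G →
      PointIdeal.SatisfiesAssumption H (PointIdeal.lowerSetOf n H) G := by
  open PointIdeal in
  induction n with
  | zero =>
    refine ⟨⟨_, rfl⟩, ?_⟩
    rintro G rfl
    exact satisfiesAssumption_zero hH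
  | succ n ih =>
    have hdata := isFibreData ih hH
    obtain ⟨x, hx⟩ := hne
    constructor
    · obtain ⟨D, G, hloop⟩ := exists_outerLoop hdata
        ⟨_, mem_lastCoords.2 ⟨x, hx, rfl⟩⟩ (Finset.Subset.refl _)
      exact ⟨G, D, hloop⟩
    · rintro G ⟨D, hloop⟩
      obtain ⟨hD, hsum, hG⟩ := hloop.invariant hdata
      -- The loop may have used another order of the fibres than the definition of `D(H)`; equal
      -- heights identify the results.
      have hDH : D = lowerSetOf (n + 1) H := by
        refine eq_of_columnHeight_eq hD (isLowerSet_lowerSetOf hH) fun a => ?_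
        rw [hsum, columnHeight_lowerSetOf_succ hH]
      rw [← hDH]
      exact hG.satisfiesAssumption (isHeightSystem_fibreProd hdata.isLowerSet hD hsum)
        fun f hf => vanishesOn_of_mem_inf_fibreIdeal hH hf
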